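/- A partition is identified with its Young diagram, a finite lower set in $(\mathbb{Z}_{\ge 0})^2$; let $(1)$ be the one-box partition. For partitions $\mu_1,\mu_2,\mu_3$ let $$L_1=\{(i,j,k):(j,k)\in\mu_1\},\quad L_2=\{(i,j,k):(k,i)\in\mu_2\},\quad L_3=\{(i,j,k):(i,j)\in\mu_3\}$$ be the legs in $(\mathbb{Z}_{\ge0})^3$ along the three coordinate axes. A 3D partition with asymptotic legs $\mu_1,\mu_2,\mu_3$ is a lower set $\pi\subset(\mathbb{Z}_{\ge0})^3$ (for the componentwise order) that contains $L_1\cup L_2\cup L_3$ and has only finitely many boxes outside it. Its renormalized number of boxes is $$|\pi|=\sum_{b\in\pi}\bigl(1-\#\{a\in\{1,2,3\}: b\in L_a\}\bigr)\in\mathbb{Z},$$ that is, the number of boxes of $\pi$ outside the legs minus the number of overlapping boxes of the legs (counted with multiplicity). The topological vertex is the formal Laurent series $$\mathsf V_{\mu_1\mu_2\mu_3}(p)=\sum_{\pi}p^{|\pi|}\in\mathbb{Q}((p)),$$ the sum being over all 3D partitions $\pi$ with asymptotic legs $\mu_1,\mu_2,\mu_3$. **Proposition.** In $\mathbb{Q}((p))[[q]]$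 one has $$\prod_{m=1}^{\infty}(1-q^m)\;\sum_{\beta}q^{|\beta|}\,p\,\frac{\mathsf V_{(1)(1)\beta}(p)}{\mathsf V_{\emptyset\emptyset\beta}(p)}\;=\;1+\frac{p}{(1-p)^2}+\sum_{d=1}^{\infty}\sum_{k\mid d}k\,\bigl(p^{k}+p^{-k}\bigr)\,q^{d},$$ where the sum on the left is over all partitions $\beta$, $|\beta|$ is the number of boxes of $\beta$, and $k$ runs over the positive divisors of $d$. (Equivalently, if $\mathsf V^{\circ}_{\mu_1\mu_2\mu_3}(p)$ counts the same 3D partitions by the number of boxes outside the legs, then $p\,\mathsf V_{(1)(1)\beta}/\mathsf V_{\emptyset\emptyset\beta}=p^{-c(\beta)}\,\mathsf V^{\circ}_{(1)(1)\beta}/\mathsf V^{\circ}_{\emptyset\emptyset\beta}$ with $c(\beta)=\#\{(i,j)\in\beta: i=0\text{ or }j=0\}$.) -/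

import Mathlib

namespace TopVertex

/-! Boxes are the points of `ℕ × ℕ × ℕ`, ordered componentwise; the box `(i, j, k)` stands for the
monomial `x ^ i * y ^ j * z ^ k`. A partition is identified with its Young diagram
(a finite lower set of `ℕ × ℕ`). -/

/-- The leg along the first coordinate axis with cross-section `μ`. -/
def leg₁ (μ : YoungDiagram) : Set (ℕ × ℕ × ℕ) := {b | (b.2.1, b.2.2) ∈ μ}

/-- The leg along the second coordinate axis with cross-section `μ`. -/
def leg₂ (μ : YoungDiagram) : Set (ℕ × ℕ × ℕ) := {b | (b.2.2, b.1) ∈ μ}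

/-- The leg along the third coordinate axis with cross-section `μ`. -/
def leg₃ (μ : YoungDiagram) : Set (ℕ × ℕ × ℕ) := {b | (b.1, b.2.1) ∈ μ}

/-- The union of the three legs: the smallest 3D partition with asymptotic legs `μ₁, μ₂, μ₃`. -/
def legs (μ₁ μ₂ μ₃ : YoungDiagram) : Set (ℕ × ℕ × ℕ) := leg₁ μ₁ ∪ leg₂ μ₂ ∪ leg₃ μ₃

/-- The 3D partitions with asymptotic legs `μ₁, μ₂, μ₃` which have exactly `n` boxes outside the
legs. They correspond to the monomial ideals obtained by adding a length `n` embedded point at the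
origin to the union of the three thickened coordinate axes. -/
def partitions3D (μ₁ μ₂ μ₃ : YoungDiagram) (n : ℕ) : Set (Set (ℕ × ℕ × ℕ)) :=
  {π | IsLowerSet π ∧ legs μ₁ μ₂ μ₃ ⊆ π ∧ (π \ legs μ₁ μ₂ μ₃).encard = n}

/-- The number of overlapping boxes of the legs: every box of `legs μ₁ μ₂ μ₃` is counted here
(the number of legs that contain it) - 1 times. -/
noncomputable def overlap (μ₁ μ₂ μ₃ : YoungDiagram) : ℕ :=
  (leg₁ μ₁ ∩ leg₂ μ₂).ncard + ((leg₁ μ₁ ∪ leg₂ μ₂) ∩ leg₃ μ₃).ncard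

/-- The formal variable `p` of the field of Laurent series `ℚ((p))`. -/
noncomputable def p : LaurentSeries ℚ := HahnSeries.single 1 1

/-- The topological vertex `V_{μ₁ μ₂ μ₃}(p)`: the generating series, in `ℚ((p))`, of the 3D
partitions `π` with asymptotic legs `μ₁, μ₂, μ₃`, counted by their renormalized number of boxes
`|π| = ∑ b ∈ π, (1 - number of legs containing b)`, which is the number of boxes outside the legs
minus `overlap μ₁ μ₂ μ₃`. -/
noncomputable def V (μ₁ μ₂ μ₃ : YoungDiagram) : LaurentSeries ℚ :=
  p ^ (-(overlap μ₁ μ₂ μ₃ : ℤ)) *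
    HahnSeries.ofPowerSeries ℤ ℚ (PowerSeries.mk fun n => ((partitions3D μ₁ μ₂ μ₃ n).ncard : ℚ))

/-- The partition `(1)`. -/
def box : YoungDiagram where
  cells := {(0, 0)}
  isLowerSet := by
    rintro ⟨a, b⟩ ⟨c, d⟩ h hab
    simp only [Finset.coe_singleton, Set.mem_singleton_iff, Prod.mk.injEq, Prod.mk_le_mk] at *
    omega

theorem finite_card_eq (d : ℕ) : {β : YoungDiagram | β.card = d}.Finite := by
  refine Set.Finite.of_finite_image (f := YoungDiagram.cells) ?_
    (fun a _ b _ h => YoungDiagram.ext h)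
  refine ((Finset.range d ×ˢ Finset.range d).powerset).finite_toSet.subset ?_
  rintro _ ⟨β, hβ, rfl⟩
  simp only [Finset.coe_powerset, Set.mem_preimage, Set.mem_powerset_iff, Finset.coe_subset]
  rintro ⟨i, j⟩ hij
  have h1 : (Finset.range (i + 1)).image (fun a => (a, j)) ⊆ β.cells := by
    intro c hc
    obtain ⟨a, ha, rfl⟩ := Finset.mem_image.1 hc
    exact β.up_left_mem (by simpa [Nat.lt_succ_iff] using ha) le_rfl hij
  have h2 : (Finset.range (j + 1)).image (fun a => (i, a)) ⊆ β.cells := by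
    intro c hc
    obtain ⟨a, ha, rfl⟩ := Finset.mem_image.1 hc
    exact β.up_left_mem le_rfl (by simpa [Nat.lt_succ_iff] using ha) hij
  have e1 := Finset.card_le_card h1
  have e2 := Finset.card_le_card h2
  rw [Finset.card_image_of_injective _ (fun a b h => (Prod.mk.inj h).1), Finset.card_range] at e1
  rw [Finset.card_image_of_injective _ (fun a b h => (Prod.mk.inj h).2), Finset.card_range] at e2
  have hd : β.cells.card = d := hβ
  simp only [Finset.mem_product, Finset.mem_range]
  omega

/-- The partitions `β` with `|β| = d`. -/
noncomputable def partitionsOfSize (d : ℕ) : Finset YoungDiagram := (finite_card_eq d).toFinset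

/-- `∑ β, f β * q ^ |β|`, the sum over all partitions, as a formal power series in `q`. -/
noncomputable def partitionSum {R : Type*} [CommRing R] (f : YoungDiagram → R) : PowerSeries R :=
  PowerSeries.mk fun d => ∑ β ∈ partitionsOfSize d, f β

/-- The infinite product `∏_{m ≥ 1} (1 - q ^ m)` as a formal power series in `q`: its coefficient
of `q ^ d` is that of the partial product over `1 ≤ m ≤ d`, see `coeff_prod_eq`. -/
noncomputable def eulerProduct (R : Type*) [CommRing R] : PowerSeries R :=
  PowerSeries.mk fun d =>
    PowerSeries.coeff d (∏ m ∈ Finset.Icc 1 d, (1 - (PowerSeries.X : PowerSeries R) ^ m))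

/-- The coefficients of the partial products of `∏_{m ≥ 1} (1 - q ^ m)` stabilize to those of
`eulerProduct`. -/
theorem coeff_prod_eq (R : Type*) [CommRing R] {d M : ℕ} (h : d ≤ M) :
    PowerSeries.coeff d (∏ m ∈ Finset.Icc 1 M, (1 - (PowerSeries.X : PowerSeries R) ^ m)) =
      PowerSeries.coeff d (eulerProduct R) := by
  induction M, h using Nat.le_induction with
  | base => simp [eulerProduct]
  | succ M hM ih =>
    rw [Finset.prod_Icc_succ_top (by omega), mul_sub, mul_one, map_sub, ih,
      PowerSeries.coeff_mul_X_pow', if_neg (by omega), sub_zero]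

end TopVertex

namespace TopVertex

/-! The core is the identity `p V_{(1)(1)β} / V_{∅∅β} = 1 + ∑_{i,j ≥ 0} p^(i + j + 1 - β_i - β'_j)`,
with `β'` the transpose of `β`; `coeff_vertex_ratio` states it coefficientwise. Column heights turn
a 3D partition into a skew plane partition outside `β` in a square of side `N + 1`, `N` large, whose
entries at the ends `(N, 0)` and `(0, N)` are 0 for `V_{∅∅β}` and 1 for `V_{(1)(1)β}`. Diagonal
toggles, an RSK-type bijection (`exists_equiv_filling`), turn skew plane partitions into arbitrary
arrays and diagonal sums into quadrant sums. Size becomes the sum of the entries weighted by outer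
hook lengths, and the two end entries become the sums of the last row and last column. If both sums
are 1, these two lines hold either a single 1 at their common corner or two 1s at some `(i, N)` and
`(N, j)`, independently of the rest, which `V_{∅∅β}` counts. The two alternatives give the term 1
and the double sum.

Next, `β` is encoded by its beta set, the beads `β_i + N - 1 - i`. Each exponent above is a hole
minus a bead, so for `k > 0` the coefficient of `p^k` counts the beads that can move up by `k`, and
that of `p^(-k)` those that can move down. Let `c_d(x)` be the sum of the coefficients of `p^x` over
`|β| = d`, and `P(d)` the number of such `β`. Each `β` has `k` more up moves than down moves, so
`c_d(k) = c_d(-k) + k P(d)` (`ratioCoeff_eq_add`). A move is reversible and changes the size by `k`,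
so `c_{d+k}(-k) = c_d(k)` (`ratioCoeff_shift`). Iterating, `c_d(-k) = k ∑_{m ≥ 1} P(d - m k)`, while
`c_d(0) = P(d)`. Thus the partition sum is the right hand side times `∑ P(d) q^d`, a factor that the
Euler product cancels. -/

open Finset

/-! ### Skew plane partitions and diagonal toggles. -/

/-- `B` is a lower set of `ℕ × ℕ`. -/
def LowerPred (B : ℕ → ℕ → Prop) : Prop :=
  ∀ i j i' j', i' ≤ i → j' ≤ j → B i j → B i' j'

/-- Arrays of natural numbers supported on the part of the square `[0, M)²` outside `B`. -/
def IsFilling (B : ℕ → ℕ → Prop) (M : ℕ) (f : ℕ → ℕ → ℕ) : Prop :=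
  ∀ i j, (B i j ∨ M ≤ i ∨ M ≤ j) → f i j = 0

/-- Skew plane partitions: fillings that weakly decrease along rows and columns outside `B`. -/
def IsSkewPP (B : ℕ → ℕ → Prop) (M : ℕ) (f : ℕ → ℕ → ℕ) : Prop :=
  IsFilling B M f ∧ ∀ i j, ¬ B i j → f (i + 1) j ≤ f i j ∧ f i (j + 1) ≤ f i j

/-- Toggle the entries of `f` on the diagonal strictly after `(s, t)` and put `x` at `(s, t)`. -/
def toggle (s t x : ℕ) (f : ℕ → ℕ → ℕ) (i j : ℕ) : ℕ :=
  if s < i ∧ i + t = j + s then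
    max (f (i + 1) j) (f i (j + 1)) + min (f (i - 1) j) (f i (j - 1)) - f i j
  else if i = s ∧ j = t then x else f i j

/-- `(i, j)` is the first box outside `B` on its diagonal. -/
def IsFirst (B : ℕ → ℕ → Prop) (i j : ℕ) : Prop :=
  ¬ B i j ∧ ∀ i' j', i = i' + 1 → j = j' + 1 → B i' j'

/-- The sum of the entries of `m` weakly to the south-east of `(i, j)`, in the square `[0, M)²`. -/
def quadrantSum (M : ℕ) (m : ℕ → ℕ → ℕ) (i j : ℕ) : ℕ :=
  ∑ a ∈ range M, ∑ b ∈ range M, if i ≤ a ∧ j ≤ b then m a b else 0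

/-- The sum of the entries of `f` along the diagonal that starts at `(i, j)`. -/
def diagonalSum (M : ℕ) (f : ℕ → ℕ → ℕ) (i j : ℕ) : ℕ := ∑ k ∈ range M, f (i + k) (j + k)

/-- `B` together with the box `(s, t)`. -/
def addBox (B : ℕ → ℕ → Prop) (s t : ℕ) (i j : ℕ) : Prop := B i j ∨ (i = s ∧ j = t)

section Toggle

variable {B : ℕ → ℕ → Prop} {M s t : ℕ}

theorem toggle_off {x i j : ℕ} {f : ℕ → ℕ → ℕ} (h : ¬ (s ≤ i ∧ i + t = j + s)) :
    toggle s t x f i j = f i j := by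
  unfold toggle
  rw [if_neg (by omega), if_neg (by omega)]

theorem toggle_self {x : ℕ} {f : ℕ → ℕ → ℕ} : toggle s t x f s t = x := by simp [toggle]

theorem toggle_succ {x k : ℕ} {f : ℕ → ℕ → ℕ} : toggle s t x f (s + k + 1) (t + k + 1) =
    max (f (s + k + 2) (t + k + 1)) (f (s + k + 1) (t + k + 2)) +
      min (f (s + k) (t + k + 1)) (f (s + k + 1) (t + k)) - f (s + k + 1) (t + k + 1) := by
  unfold toggle
  rw [if_pos (by omega)]
  rfl

theorem lowerPred_addBox (hB : LowerPred B) (hmin : ∀ i j, i ≤ s → j ≤ t → ¬ B i j → i = s ∧ j = t) :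
    LowerPred (addBox B s t) := by
  rintro i j i' j' hi hj (h | ⟨rfl, rfl⟩)
  · exact Or.inl (hB _ _ _ _ hi hj h)
  · by_cases h : B i' j'
    · exact Or.inl h
    · exact Or.inr (hmin _ _ hi hj h)

theorem not_addBox_of_le (hB : LowerPred B) (hs : ¬ B s t) {i j : ℕ} (hi : s ≤ i) (hj : t ≤ j)
    (hne : s < i ∨ t < j) : ¬ addBox B s t i j := by
  rintro (h | h)
  · exact hs (hB _ _ _ _ hi hj h)
  · omega

/-- Toggling preserves the inequalities of a skew plane partition. -/
theorem toggle_mono (hB : LowerPred B) (hs : ¬ B s t)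
    (hmin : ∀ i j, i ≤ s → j ≤ t → ¬ B i j → i = s ∧ j = t) {f : ℕ → ℕ → ℕ} {x : ℕ}
    (hf : ∀ i j, ¬ addBox B s t i j → f (i + 1) j ≤ f i j ∧ f i (j + 1) ≤ f i j) {i j : ℕ}
    (h : ¬ addBox B s t i j) :
    toggle s t x f (i + 1) j ≤ toggle s t x f i j ∧
      toggle s t x f i (j + 1) ≤ toggle s t x f i j := by
  have hn : ¬ B i j := fun h' => h (Or.inl h')
  have hne : ¬ (i = s ∧ j = t) := fun h' => h (Or.inr h')
  by_cases hd : s ≤ i ∧ i + t = j + s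
  · obtain ⟨k, rfl⟩ : ∃ k, i = s + k + 1 := ⟨i - s - 1, by omega⟩
    obtain rfl : j = t + k + 1 := by omega
    rw [toggle_off (by omega : ¬ (s ≤ s + k + 1 + 1 ∧ s + k + 1 + 1 + t = t + k + 1 + s)),
      toggle_off (by omega : ¬ (s ≤ s + k + 1 ∧ s + k + 1 + t = t + k + 1 + 1 + s)), toggle_succ]
    have h1 := (hf (s + k) (t + k + 1) (not_addBox_of_le hB hs (by omega) (by omega) (by omega))).1
    have h2 := (hf (s + k + 1) (t + k) (not_addBox_of_le hB hs (by omega) (by omega) (by omega))).2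
    simp only [add_assoc, Nat.reduceAdd] at *
    omega
  · rw [toggle_off hd]
    have hf0 := hf i j h
    constructor
    · by_cases hd1 : s ≤ i + 1 ∧ i + 1 + t = j + s
      · rcases Nat.lt_or_ge i s with hi | hi
        · exfalso; have := hmin i j (by omega) (by omega) hn; omega
        · obtain ⟨k, rfl⟩ : ∃ k, i = s + k := ⟨i - s, by omega⟩
          obtain rfl : j = t + k + 1 := by omega
          rw [toggle_succ]
          have h1 := hf (s + k + 1) (t + k + 1)
            (not_addBox_of_le hB hs (by omega) (by omega) (by omega))
          simp only [add_assoc, Nat.reduceAdd] at *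
          omega
      · rw [toggle_off hd1]; exact hf0.1
    · by_cases hd1 : s ≤ i ∧ i + t = j + 1 + s
      · rcases Nat.lt_or_ge j t with hj | hj
        · exfalso; have := hmin i j (by omega) (by omega) hn; omega
        · obtain ⟨k, rfl⟩ : ∃ k, j = t + k := ⟨j - t, by omega⟩
          obtain rfl : i = s + k + 1 := by omega
          rw [toggle_succ]
          have h1 := hf (s + k + 1) (t + k + 1)
            (not_addBox_of_le hB hs (by omega) (by omega) (by omega))
          simp only [add_assoc, Nat.reduceAdd] at *
          omega
      · rw [toggle_off hd1]; exact hf0.2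

theorem toggle_zero_of_le {f : ℕ → ℕ → ℕ} (hf : ∀ i j, (M ≤ i ∨ M ≤ j) → f i j = 0) {x i j : ℕ}
    (hs : s < M) (ht : t < M) (h : M ≤ i ∨ M ≤ j) : toggle s t x f i j = 0 := by
  by_cases hd : s ≤ i ∧ i + t = j + s
  · obtain ⟨k, rfl⟩ : ∃ k, i = s + k + 1 := ⟨i - s - 1, by omega⟩
    obtain rfl : j = t + k + 1 := by omega
    rw [toggle_succ, hf (s + k + 2) (t + k + 1) (by omega), hf (s + k + 1) (t + k + 2) (by omega)]
    rcases h with h | h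
    · rw [hf (s + k + 1) (t + k) (by omega)]; simp
    · rw [hf (s + k) (t + k + 1) (by omega)]; simp
  · rw [toggle_off hd]; exact hf _ _ h

/-- The neighbours in the toggle formula lie on the two adjacent diagonals, which do not change.
Each toggled entry is at most the minimum of its two predecessors, so the truncated subtractions are
exact. -/
theorem toggle_toggle (hB : LowerPred B) (hs : ¬ B s t) {f : ℕ → ℕ → ℕ} {x y : ℕ}
    (hf : ∀ i j, ¬ addBox B s t i j → f (i + 1) j ≤ f i j ∧ f i (j + 1) ≤ f i j) (i j : ℕ) :
    toggle s t y (toggle s t x f) i j = if i = s ∧ j = t then y else f i j := by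
  by_cases hd : s ≤ i ∧ i + t = j + s
  · rcases Nat.eq_or_lt_of_le hd.1 with rfl | hlt
    · obtain rfl : j = t := by omega
      simp [toggle_self]
    · obtain ⟨k, rfl⟩ : ∃ k, i = s + k + 1 := ⟨i - s - 1, by omega⟩
      obtain rfl : j = t + k + 1 := by omega
      rw [toggle_succ, toggle_off (by omega : ¬ (s ≤ s + k + 2 ∧ s + k + 2 + t = t + k + 1 + s)),
        toggle_off (by omega : ¬ (s ≤ s + k + 1 ∧ s + k + 1 + t = t + k + 2 + s)),
        toggle_off (by omega : ¬ (s ≤ s + k ∧ s + k + t = t + k + 1 + s)),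
        toggle_off (by omega : ¬ (s ≤ s + k + 1 ∧ s + k + 1 + t = t + k + s)), toggle_succ,
        if_neg (by omega)]
      have h1 := (hf (s + k) (t + k + 1)
        (not_addBox_of_le hB hs (by omega) (by omega) (by omega))).1
      have h2 := (hf (s + k + 1) (t + k)
        (not_addBox_of_le hB hs (by omega) (by omega) (by omega))).2
      simp only [add_assoc] at *
      omega
  · rw [toggle_off hd, toggle_off hd, if_neg (by omega)]

theorem IsSkewPP.toggle_mem (hB : LowerPred B) (hs : ¬ B s t) (hsM : s < M) (htM : t < M)
    (hmin : ∀ i j, i ≤ s → j ≤ t → ¬ B i j → i = s ∧ j = t) {f : ℕ → ℕ → ℕ} (hf : IsSkewPP B M f) :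
    IsSkewPP (addBox B s t) M (toggle s t 0 f) := by
  refine ⟨?_, fun i j h => toggle_mono hB hs hmin (fun i j h' => hf.2 i j fun h'' => h' (Or.inl h'')) h⟩
  rintro i j ((h | ⟨rfl, rfl⟩) | h)
  · rw [toggle_off]
    · exact hf.1 _ _ (Or.inl h)
    · intro h'
      exact hs (hB _ _ _ _ h'.1 (by omega) h)
  · exact toggle_self
  · exact toggle_zero_of_le (fun i j h => hf.1 i j (Or.inr h)) hsM htM h

/-- The inverse direction: the entry at `(s, t)` only has to dominate its two successors, and `n` is
its excess over their maximum. -/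
theorem IsSkewPP.toggle_mem' (hB : LowerPred B) (hs : ¬ B s t) (hsM : s < M) (htM : t < M)
    (hmin : ∀ i j, i ≤ s → j ≤ t → ¬ B i j → i = s ∧ j = t) {f : ℕ → ℕ → ℕ}
    (hf : IsSkewPP (addBox B s t) M f) (n : ℕ) :
    IsSkewPP B M (toggle s t (n + max (f (s + 1) t) (f s (t + 1))) f) := by
  refine ⟨?_, fun i j h => ?_⟩
  · rintro i j (h | h)
    · rw [toggle_off]
      · exact hf.1 _ _ (Or.inl (Or.inl h))
      · intro h'
        exact hs (hB _ _ _ _ h'.1 (by omega) h)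
    · exact toggle_zero_of_le (fun i j h => hf.1 i j (Or.inr h)) hsM htM h
  · by_cases hst : i = s ∧ j = t
    · obtain ⟨rfl, rfl⟩ := hst
      rw [toggle_self, toggle_off (by omega), toggle_off (by omega)]
      omega
    · exact toggle_mono hB hs hmin hf.2 (by rintro (h' | h') <;> tauto)

/-- Skew plane partitions outside `B` correspond to skew plane partitions outside `B` with a box
added, together with a natural number. -/
def toggleEquiv (hB : LowerPred B) (hs : ¬ B s t) (hsM : s < M) (htM : t < M)
    (hmin : ∀ i j, i ≤ s → j ≤ t → ¬ B i j → i = s ∧ j = t) :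
    {f // IsSkewPP B M f} ≃ {f // IsSkewPP (addBox B s t) M f} × ℕ where
  toFun f := (⟨toggle s t 0 f.1, f.2.toggle_mem hB hs hsM htM hmin⟩,
    f.1 s t - max (f.1 (s + 1) t) (f.1 s (t + 1)))
  invFun g := ⟨_, g.1.2.toggle_mem' hB hs hsM htM hmin g.2⟩
  left_inv f := by
    ext i j
    dsimp only
    rw [toggle_toggle hB hs (fun i j h' => f.2.2 i j fun h'' => h' (Or.inl h'')),
      toggle_off (by omega), toggle_off (by omega)]
    have := f.2.2 s t hs
    split_ifs with h
    · obtain ⟨rfl, rfl⟩ := h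
      omega
    · rfl
  right_inv g := by
    obtain ⟨g, n⟩ := g
    refine Prod.ext (Subtype.ext ?_) ?_
    · ext i j
      dsimp only
      rw [toggle_toggle hB hs g.2.2]
      split_ifs with h
      · obtain ⟨rfl, rfl⟩ := h
        exact (g.2.1 i j (Or.inl (Or.inr ⟨rfl, rfl⟩))).symm
      · rfl
    · dsimp only
      rw [toggle_self, toggle_off (by omega), toggle_off (by omega)]
      omega

/-- Removing an entry from a filling. -/
def fillingEquiv (hs : ¬ B s t) (hsM : s < M) (htM : t < M) :
    {m // IsFilling (addBox B s t) M m} × ℕ ≃ {m // IsFilling B M m} where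
  toFun m := ⟨fun i j => if i = s ∧ j = t then m.2 else m.1.1 i j, by
    rintro i j h
    dsimp only
    rw [if_neg]
    · exact m.1.2 i j (h.imp_left Or.inl)
    · rintro ⟨rfl, rfl⟩
      rcases h with h | h
      · exact hs h
      · omega⟩
  invFun m := (⟨fun i j => if i = s ∧ j = t then 0 else m.1 i j, by
    rintro i j h
    dsimp only
    split_ifs with h'
    · rfl
    · exact m.2 i j (h.imp_left fun h => h.resolve_right h')⟩, m.1 s t)
  left_inv m := by
    refine Prod.ext (Subtype.ext ?_) ?_
    · ext i j
      dsimp only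
      split_ifs with h
      · exact (m.1.2 i j (Or.inl (Or.inr h))).symm
      · rfl
    · simp
  right_inv m := by
    ext i j
    dsimp only
    split_ifs with h
    · rw [h.1, h.2]
    · rfl

theorem quadrantSum_fillingEquiv (hs : ¬ B s t) (hsM : s < M) (htM : t < M)
    (m : {m // IsFilling (addBox B s t) M m}) (n i j : ℕ) :
    quadrantSum M (fillingEquiv hs hsM htM (m, n)).1 i j =
      quadrantSum M m.1 i j + if i ≤ s ∧ j ≤ t then n else 0 := by
  have h0 : (if i ≤ s ∧ j ≤ t then n else 0) = ∑ a ∈ range M, ∑ b ∈ range M,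
      if a = s then (if b = t then (if i ≤ s ∧ j ≤ t then n else 0) else 0) else 0 := by
    rw [Finset.sum_eq_single s, Finset.sum_eq_single t]
    · simp
    · intro b _ hb; simp [hb]
    · simp [htM]
    · intro b _ hb; simp [hb]
    · simp [hsM]
  rw [h0]
  unfold quadrantSum
  simp_rw [← Finset.sum_add_distrib]
  refine Finset.sum_congr rfl fun a _ => Finset.sum_congr rfl fun b _ => ?_
  have hm := m.2 s t (Or.inl (Or.inr ⟨rfl, rfl⟩))
  simp only [fillingEquiv, Equiv.coe_fn_mk]
  by_cases ha : a = s
  · subst ha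
    by_cases hb : b = t
    · subst hb
      simp [hm]
    · simp [hb]
  · simp [ha]

/-- Inclusion-exclusion for quadrants; the only box not covered by the two smaller ones is `(s, t)`,
where `m` vanishes. -/
theorem quadrantSum_add (m : ℕ → ℕ → ℕ) (hm : m s t = 0) :
    quadrantSum M m (s + 1) t + quadrantSum M m s (t + 1) =
      quadrantSum M m s t + quadrantSum M m (s + 1) (t + 1) := by
  unfold quadrantSum
  simp_rw [← Finset.sum_add_distrib]
  refine Finset.sum_congr rfl fun a _ => Finset.sum_congr rfl fun b _ => ?_
  rcases lt_trichotomy a s with ha | rfl | ha <;> rcases lt_trichotomy b t with hb | rfl | hb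
  all_goals
    repeat rw [if_pos (by omega)]
    repeat rw [if_neg (by omega)]
  all_goals
    split_ifs <;> omega

/-- An old and a new entry at the same place add up to a `max` of successors plus a `min` of
predecessors. Along the diagonal, each `max` pairs with the next `min` of the same two entries, and
`max + min` is their sum. This is the recursion of `quadrantSum_add` with the new entry `n` added.
-/
theorem diagonalSum_toggle (hB : LowerPred B) (hs : ¬ B s t) {f : ℕ → ℕ → ℕ} (hf : IsSkewPP B M f) :
    diagonalSum M f s t + diagonalSum M (toggle s t 0 f) (s + 1) (t + 1) =
      (f s t - max (f (s + 1) t) (f s (t + 1))) + diagonalSum M (toggle s t 0 f) (s + 1) t +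
        diagonalSum M (toggle s t 0 f) s (t + 1) := by
  -- The `min` is the boundary term still unpaired after `K` steps; it vanishes at `K = M`, outside
  -- the square.
  have key : ∀ K, ∑ k ∈ range (K + 1), f (s + k) (t + k) +
      ∑ k ∈ range K, toggle s t 0 f (s + 1 + k) (t + 1 + k) +
        min (f (s + K + 1) (t + K)) (f (s + K) (t + K + 1)) =
      (f s t - max (f (s + 1) t) (f s (t + 1))) + ∑ k ∈ range (K + 1), f (s + 1 + k) (t + k) +
        ∑ k ∈ range (K + 1), f (s + k) (t + 1 + k) := by
    intro K
    induction K with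
    | zero =>
      have := hf.2 s t hs
      simp
      omega
    | succ K ih =>
      rw [Finset.sum_range_succ _ (K + 1), Finset.sum_range_succ _ (K + 1),
        Finset.sum_range_succ _ (K + 1),
        Finset.sum_range_succ (fun k => toggle s t 0 f (s + 1 + k) (t + 1 + k)) K]
      rw [show s + 1 + K = s + K + 1 by omega, show t + 1 + K = t + K + 1 by omega, toggle_succ]
      have h1 := hf.2 (s + K) (t + K + 1) (fun h => hs (hB _ _ _ _ (by omega) (by omega) h))
      have h2 := hf.2 (s + K + 1) (t + K) (fun h => hs (hB _ _ _ _ (by omega) (by omega) h))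
      rw [show s + (K + 1) = s + K + 1 by omega, show t + (K + 1) = t + K + 1 by omega,
        show s + 1 + (K + 1) = s + K + 2 by omega, show t + 1 + (K + 1) = t + K + 2 by omega]
      simp only [add_assoc, Nat.reduceAdd] at *
      omega
  have h1 : ∀ k, toggle s t 0 f (s + 1 + k) (t + k) = f (s + 1 + k) (t + k) :=
    fun k => toggle_off (by omega)
  have h2 : ∀ k, toggle s t 0 f (s + k) (t + 1 + k) = f (s + k) (t + 1 + k) :=
    fun k => toggle_off (by omega)
  have hK := key M
  rw [Finset.sum_range_succ _ M, Finset.sum_range_succ _ M, Finset.sum_range_succ _ M,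
    hf.1 (s + M) _ (by omega), hf.1 (s + 1 + M) _ (by omega),
    hf.1 (s + M) (t + 1 + M) (by omega), hf.1 (s + M + 1) _ (by omega)] at hK
  unfold diagonalSum
  simp_rw [h1, h2]
  simpa using hK

end Toggle

/-- A trace-preserving bijection between skew plane partitions and fillings: diagonal sums
correspond to quadrant sums. -/
theorem exists_equiv_filling {B : ℕ → ℕ → Prop} (hB : LowerPred B) (M : ℕ) :
    ∃ e : {f // IsSkewPP B M f} ≃ {m // IsFilling B M m}, ∀ f i j, IsFirst B i j →
      diagonalSum M f.1 i j = quadrantSum M (e f).1 i j := by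
  classical
  induction hn : (((range M) ×ˢ (range M)).filter fun c => ¬ B c.1 c.2).card using
    Nat.strong_induction_on generalizing B with
  | _ n ih =>
  by_cases hD : (((range M) ×ˢ (range M)).filter fun c => ¬ B c.1 c.2) = ∅
  · have h0 : ∀ f, IsFilling B M f → f = fun _ _ => 0 := by
      intro f hf
      ext i j
      refine hf i j ?_
      by_contra! h
      have : (i, j) ∈ (((range M) ×ˢ (range M)).filter fun c => ¬ B c.1 c.2) := by
        simp; tauto
      rw [hD] at this
      simp at this
    refine ⟨⟨fun f => ⟨f.1, f.2.1⟩, fun m => ⟨m.1, m.2, ?_⟩, fun _ => rfl, fun _ => rfl⟩, ?_⟩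
    · rw [h0 _ m.2]; simp
    · intro f i j _
      simp [h0 _ f.2.1, diagonalSum, quadrantSum]
  -- A minimal box outside `B` can be added to `B`, which peels off one free entry of the filling.
  · obtain ⟨⟨s, t⟩, hst, hmin'⟩ := Finset.exists_minimal (Finset.nonempty_iff_ne_empty.2 hD)
    simp only [mem_filter, mem_product, mem_range] at hst
    obtain ⟨⟨hsM, htM⟩, hs⟩ := hst
    have hmin : ∀ i j, i ≤ s → j ≤ t → ¬ B i j → i = s ∧ j = t := by
      intro i j hi hj h
      have := @hmin' (i, j) (by simp; exact ⟨⟨by omega, by omega⟩, h⟩) ⟨hi, hj⟩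
      exact ⟨le_antisymm hi this.1, le_antisymm hj this.2⟩
    have hB' := lowerPred_addBox hB hmin
    obtain ⟨e, he⟩ := ih _ (by
      rw [← hn]
      refine Finset.card_lt_card (Finset.ssubset_iff_subset_ne.2 ⟨fun c => ?_, fun h => ?_⟩)
      · simp only [mem_filter]
        exact fun h => ⟨h.1, fun h' => h.2 (Or.inl h')⟩
      · have : (s, t) ∈ ((range M) ×ˢ (range M)).filter fun c => ¬ addBox B s t c.1 c.2 := by
          rw [h]; simp; exact ⟨⟨hsM, htM⟩, hs⟩
        simp [addBox] at this) hB' rfl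
    refine ⟨((toggleEquiv hB hs hsM htM hmin).trans (e.prodCongr (Equiv.refl ℕ))).trans
      (fillingEquiv hs hsM htM), fun f i j hij => ?_⟩
    simp only [Equiv.trans_apply, Equiv.prodCongr_apply, Prod.map, Equiv.refl_apply,
      quadrantSum_fillingEquiv]
    set g := (toggleEquiv hB hs hsM htM hmin f).1 with hg
    have hg1 : g.1 = toggle s t 0 f.1 := rfl
    have hn1 : (toggleEquiv hB hs hsM htM hmin f).2 =
      f.1 s t - max (f.1 (s + 1) t) (f.1 s (t + 1)) := rfl
    by_cases h : i = s ∧ j = t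
    · obtain ⟨rfl, rfl⟩ := h
      have h1 := he g (i + 1) j ⟨not_addBox_of_le hB hs (by omega) (by omega) (by omega), by
        intro i' j' h1 h2
        obtain rfl : i = i' := by omega
        by_contra hc
        have := hmin i j' (by omega) (by omega) (fun h => hc (Or.inl h))
        omega⟩
      have h2 := he g i (j + 1) ⟨not_addBox_of_le hB hs (by omega) (by omega) (by omega), by
        intro i' j' h1 h2
        obtain rfl : j = j' := by omega
        by_contra hc
        have := hmin i' j (by omega) (by omega) (fun h => hc (Or.inl h))
        omega⟩
      have h3 := he g (i + 1) (j + 1)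
        ⟨not_addBox_of_le hB hs (by omega) (by omega) (by omega), by
        intro i' j' h1 h2
        exact Or.inr ⟨by omega, by omega⟩⟩
      -- Both kinds of sum at `(i, j)` obey the same recursion in terms of the three neighbouring
      -- first boxes.
      have h4 := diagonalSum_toggle hB hs f.2
      have h5 := quadrantSum_add (M := M) (e g).1 ((e g).2 i j (Or.inl (Or.inr ⟨rfl, rfl⟩)))
      rw [hg1] at h1 h2 h3
      rw [if_pos ⟨le_rfl, le_rfl⟩, hn1]
      omega
    · have hle : ¬ (i ≤ s ∧ j ≤ t) := fun h' => h (hmin i j h'.1 h'.2 hij.1)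
      rw [if_neg hle, add_zero, ← he g i j ⟨by rintro (h' | h'); exacts [hij.1 h', h h'],
        fun i' j' h1 h2 => Or.inl (hij.2 i' j' h1 h2)⟩, hg1]
      unfold diagonalSum
      refine Finset.sum_congr rfl fun k _ => (toggle_off ?_).symm
      -- The toggled diagonal starts at `(s, t)`, so no other first box lies on it.
      intro hd
      have hi : s < i ∧ t < j := by omega
      have := hij.2 (i - 1) (j - 1) (by omega) (by omega)
      exact hs (hB _ _ _ _ (by omega) (by omega) this)

/-! ### Outer hooks and the weight of a filling. -/

/-- Membership in a Young diagram as a relation. -/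
def memRel (β : YoungDiagram) (i j : ℕ) : Prop := (i, j) ∈ β

theorem lowerPred_memRel (β : YoungDiagram) : LowerPred (memRel β) :=
  fun _ _ _ _ hi hj h => β.up_left_mem hi hj h

theorem not_memRel_iff {β : YoungDiagram} {i j : ℕ} : ¬ memRel β i j ↔ β.rowLen i ≤ j := by
  rw [memRel, YoungDiagram.mem_iff_lt_rowLen, not_lt]

theorem not_memRel_iff' {β : YoungDiagram} {i j : ℕ} : ¬ memRel β i j ↔ β.colLen j ≤ i := by
  rw [memRel, YoungDiagram.mem_iff_lt_colLen, not_lt]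

/-- The hook length of a box outside `β`, the hook pointing towards `β`. -/
def outerHook (β : YoungDiagram) (i j : ℕ) : ℕ := i + j + 1 - (β.rowLen i + β.colLen j)

-- A box outside `B` is either the first on its diagonal or the shift by `(1, 1)` of a box outside
-- `B`.
open Classical in
theorem sum_outside_eq {B : ℕ → ℕ → Prop} (hB : LowerPred B) (G : ℕ → ℕ → ℕ) (I J : ℕ) :
    ∑ a ∈ range (I + 1), ∑ b ∈ range (J + 1), (if B a b then 0 else G a b) =
      (∑ a ∈ range (I + 1), ∑ b ∈ range (J + 1), if IsFirst B a b then G a b else 0) +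
        ∑ a ∈ range I, ∑ b ∈ range J, if B a b then 0 else G (a + 1) (b + 1) := by
  have h1 : ∀ a b, (if B a b then 0 else G a b) = (if IsFirst B a b then G a b else 0) +
      if ¬ B a b ∧ ¬ IsFirst B a b then G a b else 0 := by
    intro a b
    by_cases h : B a b
    · have : ¬ IsFirst B a b := fun h' => h'.1 h
      simp [h, this]
    · by_cases h' : IsFirst B a b <;> simp [h, h']
  simp_rw [h1, Finset.sum_add_distrib]
  congr 1
  rw [Finset.sum_range_succ']
  simp_rw [Finset.sum_range_succ' _ J]
  have h2 : ∀ b, ¬ (¬ B 0 b ∧ ¬ IsFirst B 0 b) := by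
    rintro b ⟨h, h'⟩
    exact h' ⟨h, fun i' j' h _ => by omega⟩
  have h3 : ∀ a, ¬ (¬ B a 0 ∧ ¬ IsFirst B a 0) := by
    rintro b ⟨h, h'⟩
    exact h' ⟨h, fun i' j' _ h => by omega⟩
  have h4 : ∀ a b, (¬ B (a + 1) (b + 1) ∧ ¬ IsFirst B (a + 1) (b + 1)) ↔ ¬ B a b := by
    intro a b
    constructor
    · rintro ⟨h, h'⟩ hab
      exact h' ⟨h, fun i' j' hi hj => by
        obtain rfl : a = i' := by omega
        obtain rfl : b = j' := by omega
        exact hab⟩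
    · intro h
      refine ⟨fun h' => h (hB _ _ _ _ (by omega) (by omega) h'), fun h' => h (h'.2 a b rfl rfl)⟩
  simp [h2, h3, h4]

open Classical in
theorem sum_row_outside (β : YoungDiagram) (i n : ℕ) (h : β.rowLen i ≤ n) :
    ∑ b ∈ range n, (if memRel β i b then 0 else 1) = n - β.rowLen i := by
  have : ∀ b, (if memRel β i b then 0 else 1) = if b < β.rowLen i then 0 else 1 := fun b => by
    simp only [memRel, YoungDiagram.mem_iff_lt_rowLen]
  simp_rw [this]
  obtain ⟨k, rfl⟩ := Nat.exists_eq_add_of_le h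
  rw [Finset.sum_range_add]
  simp [Finset.sum_ite]

open Classical in
theorem sum_col_outside (β : YoungDiagram) (j n : ℕ) (h : β.colLen j ≤ n) :
    ∑ a ∈ range n, (if memRel β a j then 0 else 1) = n - β.colLen j := by
  have : ∀ b, (if memRel β b j then 0 else 1) = if b < β.colLen j then 0 else 1 := fun b => by
    simp only [memRel, YoungDiagram.mem_iff_lt_colLen]
  simp_rw [this]
  obtain ⟨k, rfl⟩ := Nat.exists_eq_add_of_le h
  rw [Finset.sum_range_add]
  simp [Finset.sum_ite]

open Classical in
/-- The outer hook length counts the diagonals that start weakly north-west of the box. -/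
theorem card_isFirst (β : YoungDiagram) {i j : ℕ} (h : ¬ memRel β i j) :
    ∑ a ∈ range (i + 1), ∑ b ∈ range (j + 1), (if IsFirst (memRel β) a b then 1 else 0) =
      outerHook β i j := by
  -- The number of first boxes is the difference of two counts outside `β`: a last row with `j + 1 -
  -- β.rowLen i` boxes and a last column with `i - β.colLen j`.
  have h1 := sum_outside_eq (lowerPred_memRel β) (fun _ _ => 1) i j
  have hr := not_memRel_iff.1 h
  have hc := not_memRel_iff'.1 h
  rw [Finset.sum_range_succ (fun a => ∑ b ∈ range (j + 1), if memRel β a b then 0 else 1),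
    sum_row_outside _ _ _ (by omega)] at h1
  simp_rw [Finset.sum_range_succ (fun b => if memRel β _ b then 0 else 1) j,
    Finset.sum_add_distrib, sum_col_outside β j i hc] at h1
  unfold outerHook
  omega

-- `sum_outside_eq` for `G = diagonalSum M f`: the difference between a diagonal sum and its shift
-- by `(1, 1)` is the entry itself.
open Classical in
theorem sum_eq_sum_diagonalSum {B : ℕ → ℕ → Prop} (hB : LowerPred B) {M : ℕ} {f : ℕ → ℕ → ℕ}
    (hf : IsFilling B M f) : ∑ a ∈ range M, ∑ b ∈ range M, f a b =
      ∑ a ∈ range (M + 1), ∑ b ∈ range (M + 1),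
        if IsFirst B a b then diagonalSum M f a b else 0 := by
  have hg : ∀ a b, diagonalSum M f a b = f a b + diagonalSum M f (a + 1) (b + 1) := by
    intro a b
    have h1 := Finset.sum_range_succ (fun k => f (a + k) (b + k)) M
    rw [Finset.sum_range_succ', hf (a + M) _ (by omega)] at h1
    simp only [← add_assoc, add_zero, add_right_comm _ _ 1] at h1
    unfold diagonalSum
    omega
  have h1 := sum_outside_eq hB (diagonalSum M f) M M
  have hz : ∀ a b, M ≤ a ∨ M ≤ b → diagonalSum M f a b = 0 := by
    intro a b h
    exact Finset.sum_eq_zero fun k _ => hf _ _ (by omega)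
  simp_rw [Finset.sum_range_succ (fun b => if B _ b then 0 else _) M] at h1
  rw [Finset.sum_range_succ (fun a => _ + _) M] at h1
  simp only [hz M _ (Or.inl le_rfl), hz _ M (Or.inr le_rfl), ite_self, add_zero,
    Finset.sum_const_zero] at h1
  have h2 : ∀ a b, (if B a b then 0 else diagonalSum M f a b) =
      f a b + if B a b then 0 else diagonalSum M f (a + 1) (b + 1) := by
    intro a b
    split_ifs with h
    · rw [hf _ _ (Or.inl h)]
    · exact hg a b
  simp_rw [h2, Finset.sum_add_distrib] at h1
  omega

/-- The weight of a filling: every box counts with its outer hook length. -/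
def hookWeight (β : YoungDiagram) (M : ℕ) (m : ℕ → ℕ → ℕ) : ℕ :=
  ∑ a ∈ range M, ∑ b ∈ range M, m a b * outerHook β a b

-- After exchanging sums, `m c d` is counted once for every first box weakly north-west of `(c, d)`,
-- which is `outerHook β c d` times by `card_isFirst`.
open Classical in
theorem sum_isFirst_quadrantSum (β : YoungDiagram) {M : ℕ} {m : ℕ → ℕ → ℕ}
    (hm : IsFilling (memRel β) M m) : ∑ a ∈ range (M + 1), ∑ b ∈ range (M + 1),
      (if IsFirst (memRel β) a b then quadrantSum M m a b else 0) = hookWeight β M m := by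
  have h1 : ∀ a b, (if IsFirst (memRel β) a b then quadrantSum M m a b else 0) =
      ∑ c ∈ range M, ∑ d ∈ range M,
        m c d * (if IsFirst (memRel β) a b ∧ a ≤ c ∧ b ≤ d then 1 else 0) := by
    intro a b
    unfold quadrantSum
    split_ifs with h <;> simp [h]
  simp_rw [h1]
  unfold hookWeight
  refine Eq.trans (b := ∑ c ∈ range M, ∑ d ∈ range M, ∑ a ∈ range (M + 1), ∑ b ∈ range (M + 1),
    m c d * (if IsFirst (memRel β) a b ∧ a ≤ c ∧ b ≤ d then 1 else 0)) ?_ ?_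
  · rw [Finset.sum_congr rfl fun a _ => Finset.sum_comm, Finset.sum_comm]
    refine Finset.sum_congr rfl fun c _ => ?_
    rw [Finset.sum_congr rfl fun a _ => Finset.sum_comm, Finset.sum_comm]
  · refine Finset.sum_congr rfl fun c hc => Finset.sum_congr rfl fun d hd => ?_
    rw [Finset.mem_range] at hc hd
    simp_rw [← Finset.mul_sum]
    by_cases h : memRel β c d
    · simp [hm _ _ (Or.inl h)]
    · rw [← card_isFirst β h]
      congr 1
      have hab : ∀ a b, (if IsFirst (memRel β) a b ∧ a ≤ c ∧ b ≤ d then 1 else 0) =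
          if a < c + 1 then (if b < d + 1 then (if IsFirst (memRel β) a b then 1 else 0)
            else 0) else 0 := by
        intro a b
        simp only [Nat.lt_succ_iff]
        split_ifs <;> tauto
      have hr : ∀ c, c < M → (range (M + 1)).filter (fun a => a < c + 1) = range (c + 1) := by
        intro c hc
        ext a
        simp
        omega
      simp_rw [hab]
      rw [← hr c hc, Finset.sum_filter]
      refine Finset.sum_congr rfl fun a _ => ?_
      split_ifs with ha
      · rw [← hr d hd, Finset.sum_filter]
      · simp

/-- In a square of side `N + 1` the diagonal from `(N, 0)` has a single entry and the quadrant at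
`(N, 0)` is the last row; similarly for `(0, N)` and the last column. -/
theorem exists_equiv_hookWeight (β : YoungDiagram) {N : ℕ} (hr : β.rowLen 0 ≤ N)
    (hc : β.colLen 0 ≤ N) :
    ∃ e : {f // IsSkewPP (memRel β) (N + 1) f} ≃ {m // IsFilling (memRel β) (N + 1) m}, ∀ f,
      f.1 N 0 = ∑ b ∈ range (N + 1), (e f).1 N b ∧ f.1 0 N = ∑ a ∈ range (N + 1), (e f).1 a N ∧
        ∑ a ∈ range (N + 1), ∑ b ∈ range (N + 1), f.1 a b = hookWeight β (N + 1) (e f).1 := by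
  obtain ⟨e, he⟩ := exists_equiv_filling (lowerPred_memRel β) (N + 1)
  refine ⟨e, fun f => ⟨?_, ?_, ?_⟩⟩
  · have h := he f N 0 ⟨not_memRel_iff'.2 hc, fun i' j' _ h => by omega⟩
    unfold diagonalSum quadrantSum at h
    rw [Finset.sum_range_succ', Finset.sum_eq_zero fun k _ => f.2.1 _ _ (by omega),
      Finset.sum_range_succ, Finset.sum_eq_zero (s := range N)] at h
    · simpa using h
    · intro a ha
      rw [Finset.mem_range] at ha
      exact Finset.sum_eq_zero fun b _ => if_neg (by omega)
  · have h := he f 0 N ⟨not_memRel_iff.2 hr, fun i' j' h _ => by omega⟩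
    unfold diagonalSum quadrantSum at h
    rw [Finset.sum_range_succ', Finset.sum_eq_zero fun k _ => f.2.1 _ _ (by omega),
      Finset.sum_comm, Finset.sum_range_succ, Finset.sum_eq_zero (s := range N)] at h
    · simpa using h
    · intro a ha
      rw [Finset.mem_range] at ha
      exact Finset.sum_eq_zero fun b _ => if_neg (by omega)
  · classical
    rw [sum_eq_sum_diagonalSum (lowerPred_memRel β) f.2.1, ← sum_isFirst_quadrantSum β (e f).2]
    refine Finset.sum_congr rfl fun a _ => Finset.sum_congr rfl fun b _ => ?_
    split_ifs with h
    · exact he f a b h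
    · rfl

theorem outerHook_add {β : YoungDiagram} {i j : ℕ} (h : ¬ memRel β i j) :
    outerHook β i j + β.rowLen i + β.colLen j = i + j + 1 := by
  have := not_memRel_iff.1 h
  have := not_memRel_iff'.1 h
  unfold outerHook
  omega

theorem rowLen_eq_zero {β : YoungDiagram} {N i : ℕ} (hc : β.colLen 0 ≤ N) (hi : N ≤ i) :
    β.rowLen i = 0 :=
  Nat.le_zero.1 (not_memRel_iff.1 (not_memRel_iff'.2 (hc.trans hi)))

theorem colLen_eq_zero {β : YoungDiagram} {N j : ℕ} (hr : β.rowLen 0 ≤ N) (hj : N ≤ j) :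
    β.colLen j = 0 :=
  Nat.le_zero.1 (not_memRel_iff'.1 (not_memRel_iff.2 (hr.trans hj)))

/-- Outer hooks are at least 1, so `w` bounds every entry. Finiteness allows `Nat.card` of a sigma
type to be written as a sum in `edgeCount_one`. -/
theorem finite_filling (β : YoungDiagram) (N w : ℕ) :
    Finite {m : {m // IsFilling (memRel β) N m} // hookWeight β N m.1 = w} := by
  have hle : ∀ m : {m : {m // IsFilling (memRel β) N m} // hookWeight β N m.1 = w}, ∀ i j,
      m.1.1 i j ≤ w := by
    rintro ⟨m, hw⟩ i j
    by_cases h : memRel β i j ∨ N ≤ i ∨ N ≤ j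
    · rw [m.2 i j h]; exact Nat.zero_le _
    · push Not at h
      dsimp only
      have h1 : 1 ≤ outerHook β i j := by
        have := not_memRel_iff.1 h.1
        have := not_memRel_iff'.1 h.1
        unfold outerHook
        omega
      calc m.1 i j ≤ m.1 i j * outerHook β i j := Nat.le_mul_of_pos_right _ h1
        _ ≤ ∑ b ∈ range N, m.1 i b * outerHook β i b :=
          Finset.single_le_sum (f := fun b => m.1 i b * outerHook β i b)
            (fun _ _ => Nat.zero_le _) (Finset.mem_range.2 h.2.2)
        _ ≤ hookWeight β N m.1 :=
          Finset.single_le_sum (f := fun a => ∑ b ∈ range N, m.1 a b * outerHook β a b)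
            (fun _ _ => Nat.zero_le _) (Finset.mem_range.2 h.2.1)
        _ = w := hw
  refine Finite.of_injective (β := Fin N → Fin N → Fin (w + 1))
    (fun m i j => ⟨m.1.1 i j, Nat.lt_succ_of_le (hle m i j)⟩) ?_
  intro m m' h
  ext i j
  by_cases h' : i < N ∧ j < N
  · have := congrFun (congrFun h ⟨i, h'.1⟩) ⟨j, h'.2⟩
    simpa using this
  · rw [m.1.2 i j (by omega), m'.1.2 i j (by omega)]

/-! ### Fillings with prescribed sums of the last row and column. -/

/-- The fillings of the outer row and column of a square of size `N + 1` with line sums `1`. -/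
def edgeArray (N : ℕ) : Option (Fin N × Fin N) → ℕ → ℕ → ℕ
  | none => fun a b => if a = N ∧ b = N then 1 else 0
  | some (i, j) => fun a b => (if a = i ∧ b = N then 1 else 0) + if a = N ∧ b = j then 1 else 0

/-- The weight of `edgeArray`. -/
def edgeWeight (β : YoungDiagram) (N : ℕ) : Option (Fin N × Fin N) → ℕ
  | none => outerHook β N N
  | some (i, j) => outerHook β i N + outerHook β N j

theorem exists_of_sum_eq_one {N : ℕ} {g : ℕ → ℕ} (h : ∑ b ∈ range N, g b = 1) :
    ∃ j : Fin N, ∀ b < N, g b = if b = j then 1 else 0 := by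
  obtain ⟨j, hj, hj0⟩ := Finset.exists_ne_zero_of_sum_ne_zero (by rw [h]; exact one_ne_zero)
  rw [← Finset.add_sum_erase _ _ hj] at h
  have h0 : ∑ b ∈ (range N).erase j, g b = 0 := by omega
  rw [Finset.sum_eq_zero_iff] at h0
  refine ⟨⟨j, Finset.mem_range.1 hj⟩, fun b hb => ?_⟩
  dsimp only
  split_ifs with hbj
  · subst hbj; omega
  · exact h0 b (Finset.mem_erase.2 ⟨hbj, Finset.mem_range.2 hb⟩)

/-- The fillings of a square of size `N + 1` with line sums `1` in the outer row and column. -/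
abbrev EdgeFilling (β : YoungDiagram) (N : ℕ) :=
  {m : {m // IsFilling (memRel β) (N + 1) m} //
    ∑ b ∈ range (N + 1), m.1 N b = 1 ∧ ∑ a ∈ range (N + 1), m.1 a N = 1}

section

variable {β : YoungDiagram} {N : ℕ}

theorem edgeArray_last_row (κ : Option (Fin N × Fin N)) :
    ∑ b ∈ range (N + 1), edgeArray N κ N b = 1 := by
  rcases κ with _ | ⟨i, j⟩
  · simp [edgeArray]
  · have hj := j.2
    have hi := i.2
    simp [edgeArray, hi.ne']

theorem edgeArray_last_col (κ : Option (Fin N × Fin N)) :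
    ∑ a ∈ range (N + 1), edgeArray N κ a N = 1 := by
  rcases κ with _ | ⟨i, j⟩
  · simp [edgeArray]
  · have hj := j.2
    have hi := i.2
    simp [edgeArray, hj.ne']

theorem edgeArray_inner (κ : Option (Fin N × Fin N)) {a b : ℕ} (ha : a < N) (hb : b < N) :
    edgeArray N κ a b = 0 := by
  rcases κ with _ | ⟨i, j⟩ <;> simp [edgeArray, ha.ne, hb.ne]

theorem hookWeight_edgeArray (κ : Option (Fin N × Fin N)) :
    hookWeight β (N + 1) (edgeArray N κ) = edgeWeight β N κ := by
  unfold hookWeight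
  rw [Finset.sum_range_succ]
  rcases κ with _ | ⟨i, j⟩
  · rw [Finset.sum_eq_zero, Finset.sum_range_succ, Finset.sum_eq_zero]
    · simp [edgeArray, edgeWeight]
    · intro b hb
      rw [Finset.mem_range] at hb
      simp [edgeArray, hb.ne]
    · intro a ha
      rw [Finset.mem_range] at ha
      simp [edgeArray, ha.ne]
  · have hi := i.2
    have hj := j.2
    congr 1
    · rw [Finset.sum_eq_single (i : ℕ)]
      · rw [Finset.sum_eq_single N]
        · simp [edgeArray, hi.ne]
        · intro b _ hb
          simp [edgeArray, hb, hi.ne]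
        · simp
      · intro a ha hai
        rw [Finset.mem_range] at ha
        simp [edgeArray, hai, ha.ne]
      · simp
    · rw [Finset.sum_eq_single (j : ℕ)]
      · simp [edgeArray, hi.ne']
      · intro b _ hb
        simp [edgeArray, hb, hi.ne']
      · simp

theorem hookWeight_succ {m : ℕ → ℕ → ℕ} (hm : IsFilling (memRel β) N m) :
    hookWeight β (N + 1) m = hookWeight β N m := by
  unfold hookWeight
  rw [Finset.sum_range_succ]
  simp_rw [Finset.sum_range_succ _ N]
  simp [hm N _ (by omega), hm _ N (by omega)]

theorem hookWeight_add (M : ℕ) (m m' : ℕ → ℕ → ℕ) :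
    hookWeight β M (fun a b => m a b + m' a b) = hookWeight β M m + hookWeight β M m' := by
  simp [hookWeight, add_mul, Finset.sum_add_distrib]

/-- Adding an outer row and column with line sums `1` to a filling. -/
def glueEdge (hr : β.rowLen 0 ≤ N) (hc : β.colLen 0 ≤ N)
    (x : Option (Fin N × Fin N) × {m // IsFilling (memRel β) N m}) : EdgeFilling β N :=
  ⟨⟨fun a b => x.2.1 a b + edgeArray N x.1 a b, by
    rintro a b h
    dsimp only
    rw [x.2.2 a b (h.imp_right fun h => by omega), zero_add]
    rcases h with h | h
    · have ha : a < N := by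
        by_contra h'
        rw [memRel, YoungDiagram.mem_iff_lt_rowLen, rowLen_eq_zero hc (not_lt.1 h')] at h
        omega
      have hb : b < N := by
        by_contra h'
        rw [memRel, YoungDiagram.mem_iff_lt_colLen, colLen_eq_zero hr (not_lt.1 h')] at h
        omega
      exact edgeArray_inner _ ha hb
    · obtain ⟨_ | ⟨i, j⟩, m⟩ := x
      · simp only [edgeArray]
        rw [if_neg (by omega)]
      · have hi := i.2
        have hj := j.2
        simp only [edgeArray]
        rw [if_neg (by omega), if_neg (by omega)]⟩, by
    constructor
    · simp only [Finset.sum_add_distrib, edgeArray_last_row]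
      rw [Finset.sum_eq_zero fun b _ => x.2.2 _ _ (by omega)]
    · simp only [Finset.sum_add_distrib, edgeArray_last_col]
      rw [Finset.sum_eq_zero fun b _ => x.2.2 _ _ (by omega)]⟩

theorem glueEdge_bijective (hr : β.rowLen 0 ≤ N) (hc : β.colLen 0 ≤ N) :
    Function.Bijective (glueEdge hr hc) := by
  constructor
  · rintro ⟨κ, m⟩ ⟨κ', m'⟩ h
    have h0 : ∀ a b, m.1 a b + edgeArray N κ a b = m'.1 a b + edgeArray N κ' a b := fun a b =>
      congrFun (congrFun (congrArg (fun z => z.1.1) h) a) b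
    refine Prod.ext ?_ (Subtype.ext ?_)
    · have h1 : ∀ b, edgeArray N κ N b = edgeArray N κ' N b := fun b => by
        have := h0 N b
        rwa [m.2 N b (by omega), m'.2 N b (by omega), zero_add, zero_add] at this
      have h2 : ∀ a, edgeArray N κ a N = edgeArray N κ' a N := fun b => by
        have := h0 b N
        rwa [m.2 b N (by omega), m'.2 b N (by omega), zero_add, zero_add] at this
      rcases κ with _ | ⟨i, j⟩ <;> rcases κ' with _ | ⟨i', j'⟩
      · rfl
      · have := h1 N
        have hi := i'.2
        have hj := j'.2
        simp [edgeArray, hi.ne', hj.ne'] at this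
      · have := h1 N
        have hi := i.2
        have hj := j.2
        simp [edgeArray, hi.ne', hj.ne'] at this
      · have h1 := h1 j
        have h2 := h2 i
        have hi := i.2
        have hj := j.2
        have hi' := i'.2
        have hj' := j'.2
        simp only [edgeArray, hi.ne', hi'.ne', hj.ne', hj'.ne', false_and, and_false, if_false,
          true_and, and_true, if_true, zero_add, add_zero] at h1 h2
        have hjj : (j : ℕ) = j' := by
          by_contra hne
          rw [if_neg (by omega)] at h1
          omega
        have hii : (i : ℕ) = i' := by
          by_contra hne
          rw [if_neg (by omega)] at h2
          omega
        rw [Fin.ext hjj, Fin.ext hii]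
    · ext a b
      dsimp only
      by_cases hab : a < N ∧ b < N
      · have := h0 a b
        rwa [edgeArray_inner _ hab.1 hab.2, edgeArray_inner _ hab.1 hab.2] at this
      · rw [m.2 a b (by omega), m'.2 a b (by omega)]
  · rintro ⟨⟨m, hm⟩, hrow, hcol⟩
    dsimp only at hrow hcol
    have hinner : IsFilling (memRel β) N (fun a b => if a < N ∧ b < N then m a b else 0) := by
      intro a b h
      dsimp only
      split_ifs with h'
      · exact hm a b (h.imp_right fun h => by omega)
      · rfl
    obtain ⟨κ, hκ⟩ : ∃ κ, (∀ b < N + 1, m N b = edgeArray N κ N b) ∧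
        (∀ a < N + 1, m a N = edgeArray N κ a N) := by
      rw [Finset.sum_range_succ] at hrow hcol
      -- The corner `(N, N)` belongs to both lines: if it is nonzero it uses up both sums, otherwise
      -- each line has its own 1.
      by_cases hNN : m N N = 0
      · obtain ⟨j, hj⟩ := exists_of_sum_eq_one (by omega : ∑ b ∈ range N, m N b = 1)
        obtain ⟨i, hi⟩ := exists_of_sum_eq_one (by omega : ∑ a ∈ range N, m a N = 1)
        have hi' := i.2
        have hj' := j.2
        refine ⟨some (i, j), fun b hb => ?_, fun a ha => ?_⟩
        · rcases Nat.lt_succ_iff_lt_or_eq.1 hb with hb | rfl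
          · rw [hj b hb]; simp [edgeArray, hb.ne]
          · simp [edgeArray, hi'.ne', hj'.ne', hNN]
        · rcases Nat.lt_succ_iff_lt_or_eq.1 ha with ha | rfl
          · rw [hi a ha]; simp [edgeArray, ha.ne]
          · simp [edgeArray, hi'.ne', hj'.ne', hNN]
      · have h1 : ∑ b ∈ range N, m N b = 0 := by omega
        have h2 : ∑ a ∈ range N, m a N = 0 := by omega
        rw [Finset.sum_eq_zero_iff] at h1 h2
        refine ⟨none, fun b hb => ?_, fun a ha => ?_⟩
        · rcases Nat.lt_succ_iff_lt_or_eq.1 hb with hb | rfl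
          · rw [h1 b (Finset.mem_range.2 hb)]; simp [edgeArray, hb.ne]
          · simp [edgeArray]; omega
        · rcases Nat.lt_succ_iff_lt_or_eq.1 ha with ha | rfl
          · rw [h2 a (Finset.mem_range.2 ha)]; simp [edgeArray, ha.ne]
          · simp [edgeArray]; omega
    refine ⟨(κ, ⟨_, hinner⟩), Subtype.ext (Subtype.ext ?_)⟩
    ext a b
    simp only [glueEdge]
    by_cases hab : a < N ∧ b < N
    · rw [if_pos hab, edgeArray_inner _ hab.1 hab.2, add_zero]
    · rw [if_neg hab, zero_add]
      by_cases hab' : a < N + 1 ∧ b < N + 1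
      · by_cases ha : a = N
        · rw [ha, hκ.1 b hab'.2]
        · obtain rfl : b = N := by omega
          rw [hκ.2 a hab'.1]
      · rw [hm a b (by omega)]
        rcases κ with _ | ⟨i, j⟩
        · simp only [edgeArray]
          rw [if_neg (by omega)]
        · have hi := i.2
          have hj := j.2
          simp only [edgeArray]
          rw [if_neg (by omega), if_neg (by omega)]

theorem hookWeight_glueEdge (hr : β.rowLen 0 ≤ N) (hc : β.colLen 0 ≤ N)
    (x : Option (Fin N × Fin N) × {m // IsFilling (memRel β) N m}) :
    hookWeight β (N + 1) (glueEdge hr hc x).1.1 = edgeWeight β N x.1 + hookWeight β N x.2.1 := by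
  simp only [glueEdge]
  rw [hookWeight_add, hookWeight_succ x.2.2, hookWeight_edgeArray, add_comm]

end

/-- The number of skew plane partitions in the square of size `N + 1` outside `β`, with entries
`ε` at the ends of the axes and with sum of entries `w`. -/
noncomputable def edgeCount (β : YoungDiagram) (N ε w : ℕ) : ℕ :=
  {f | IsSkewPP (memRel β) (N + 1) f ∧ (f N 0 = ε ∧ f 0 N = ε) ∧
    ∑ a ∈ range (N + 1), ∑ b ∈ range (N + 1), f a b = w}.ncard

theorem edgeCount_eq {β : YoungDiagram} {N : ℕ} (hr : β.rowLen 0 ≤ N)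
    (hc : β.colLen 0 ≤ N) (ε w : ℕ) :
    edgeCount β N ε w = Nat.card {m : {m // IsFilling (memRel β) (N + 1) m} //
      (∑ b ∈ range (N + 1), m.1 N b = ε ∧ ∑ a ∈ range (N + 1), m.1 a N = ε) ∧
        hookWeight β (N + 1) m.1 = w} := by
  obtain ⟨e, he⟩ := exists_equiv_hookWeight β hr hc
  rw [edgeCount, ← Nat.card_coe_set_eq]
  refine (Nat.card_congr (Equiv.subtypeSubtypeEquivSubtypeInter (IsSkewPP (memRel β) (N + 1))
    fun f => (f N 0 = ε ∧ f 0 N = ε) ∧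
      ∑ a ∈ range (N + 1), ∑ b ∈ range (N + 1), f a b = w)).symm.trans ?_
  refine Nat.card_congr (e.subtypeEquiv fun f => ?_)
  obtain ⟨h1, h2, h3⟩ := he f
  rw [h1, h2, h3]

theorem edgeCount_zero {β : YoungDiagram} {N : ℕ} (hr : β.rowLen 0 ≤ N)
    (hc : β.colLen 0 ≤ N) (w : ℕ) : edgeCount β N 0 w =
      Nat.card {m : {m // IsFilling (memRel β) N m} // hookWeight β N m.1 = w} := by
  rw [edgeCount_eq hr hc]
  have hz : ∀ m : ℕ → ℕ → ℕ, IsFilling (memRel β) (N + 1) m → ∑ b ∈ range (N + 1), m N b = 0 →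
      ∑ a ∈ range (N + 1), m a N = 0 → IsFilling (memRel β) N m := by
    intro m hm h1 h2 i j h
    rw [Finset.sum_eq_zero_iff] at h1 h2
    by_cases h' : memRel β i j ∨ N + 1 ≤ i ∨ N + 1 ≤ j
    · exact hm i j h'
    · push Not at h'
      by_cases hi : i = N
      · rw [hi]; exact h1 j (Finset.mem_range.2 h'.2.2)
      · obtain rfl : j = N := by have := h.resolve_left h'.1; omega
        exact h2 i (Finset.mem_range.2 h'.2.1)
  refine Nat.card_congr ⟨fun m => ⟨⟨m.1.1, hz _ m.1.2 m.2.1.1 m.2.1.2⟩, ?_⟩,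
    fun m => ⟨⟨m.1.1, fun i j h => m.1.2 i j (h.imp_right fun h => by omega)⟩, ?_⟩, fun _ => rfl, fun _ => rfl⟩
  · rw [← hookWeight_succ (hz _ m.1.2 m.2.1.1 m.2.1.2)]
    exact m.2.2
  · exact ⟨⟨Finset.sum_eq_zero fun b _ => m.1.2 _ _ (by omega),
      Finset.sum_eq_zero fun b _ => m.1.2 _ _ (by omega)⟩, by rw [hookWeight_succ m.1.2, m.2]⟩

/-- The recursion that computes the topological vertex with two one-box legs. -/
theorem edgeCount_one {β : YoungDiagram} {N : ℕ} (hr : β.rowLen 0 ≤ N)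
    (hc : β.colLen 0 ≤ N) (w : ℕ) : edgeCount β N 1 w =
      ∑ κ, if edgeWeight β N κ ≤ w then edgeCount β N 0 (w - edgeWeight β N κ) else 0 := by
  rw [edgeCount_eq hr hc]
  have e1 : {m : {m // IsFilling (memRel β) (N + 1) m} //
      (∑ b ∈ range (N + 1), m.1 N b = 1 ∧ ∑ a ∈ range (N + 1), m.1 a N = 1) ∧
        hookWeight β (N + 1) m.1 = w} ≃
      {x : Option (Fin N × Fin N) × {m // IsFilling (memRel β) N m} //
        edgeWeight β N x.1 + hookWeight β N x.2.1 = w} :=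
    (Equiv.subtypeSubtypeEquivSubtypeInter _ _).symm.trans
      ((Equiv.ofBijective _ (glueEdge_bijective hr hc)).subtypeEquiv fun x => by
        rw [Equiv.ofBijective_apply, hookWeight_glueEdge]).symm
  have e2 : {x : Option (Fin N × Fin N) × {m // IsFilling (memRel β) N m} //
        edgeWeight β N x.1 + hookWeight β N x.2.1 = w} ≃
      Σ κ, {m : {m // IsFilling (memRel β) N m} // edgeWeight β N κ + hookWeight β N m.1 = w} :=
    ⟨fun x => ⟨x.1.1, x.1.2, x.2⟩, fun x => ⟨(x.1, x.2.1), x.2.2⟩, fun _ => rfl, fun _ => rfl⟩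
  have e3 : ∀ κ, edgeWeight β N κ ≤ w →
      {m : {m // IsFilling (memRel β) N m} // edgeWeight β N κ + hookWeight β N m.1 = w} ≃
      {m : {m // IsFilling (memRel β) N m} // hookWeight β N m.1 = w - edgeWeight β N κ} :=
    fun κ hκ => Equiv.subtypeEquivRight fun m => by omega
  have hemp : ∀ κ, ¬ edgeWeight β N κ ≤ w → IsEmpty
      {m : {m // IsFilling (memRel β) N m} // edgeWeight β N κ + hookWeight β N m.1 = w} :=
    fun κ hκ => ⟨fun m => by have := m.2; omega⟩
  have hfin : ∀ κ, Finite
      {m : {m // IsFilling (memRel β) N m} // edgeWeight β N κ + hookWeight β N m.1 = w} := by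
    intro κ
    by_cases hκ : edgeWeight β N κ ≤ w
    · have := finite_filling β N (w - edgeWeight β N κ)
      exact Finite.of_equiv _ (e3 κ hκ).symm
    · have := hemp κ hκ
      infer_instance
  rw [Nat.card_congr (e1.trans e2), Nat.card_sigma]
  refine Finset.sum_congr rfl fun κ _ => ?_
  split_ifs with hκ
  · rw [edgeCount_zero hr hc, Nat.card_congr (e3 κ hκ)]
  · have := hemp κ hκ
    exact Nat.card_of_isEmpty

/-! ### 3D partitions as skew plane partitions. -/

/-- The leg along the third axis with cross-section `β`, together with `ε` layers of the two
coordinate half-lines of the plane orthogonal to it. -/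
def axisLegs (β : YoungDiagram) (ε : ℕ) : Set (ℕ × ℕ × ℕ) :=
  {b | memRel β b.1 b.2.1 ∨ (b.2.2 < ε ∧ (b.1 = 0 ∨ b.2.1 = 0))}

theorem mem_axisLegs {β : YoungDiagram} {ε i j k : ℕ} :
    (i, j, k) ∈ axisLegs β ε ↔ memRel β i j ∨ (k < ε ∧ (i = 0 ∨ j = 0)) := Iff.rfl

theorem mem_box {c : ℕ × ℕ} : c ∈ box ↔ c = (0, 0) := by
  rw [← YoungDiagram.mem_cells]
  simp [box]

theorem legs_box_box (β : YoungDiagram) : legs box box β = axisLegs β 1 := by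
  ext ⟨i, j, k⟩
  simp only [legs, leg₁, leg₂, leg₃, axisLegs, mem_box, memRel, Set.mem_union, Set.mem_ofPred_eq,
    Prod.mk.injEq]
  constructor
  · rintro ((h | h) | h)
    · exact Or.inr ⟨by omega, Or.inr h.1⟩
    · exact Or.inr ⟨by omega, Or.inl h.2⟩
    · exact Or.inl h
  · rintro (h | ⟨h, h' | h'⟩)
    · exact Or.inr h
    · exact Or.inl (Or.inr ⟨by omega, h'⟩)
    · exact Or.inl (Or.inl ⟨h', by omega⟩)

theorem legs_bot_bot (β : YoungDiagram) : legs ⊥ ⊥ β = axisLegs β 0 := by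
  ext ⟨i, j, k⟩
  simp [legs, leg₁, leg₂, leg₃, axisLegs, memRel]

/-- The 3D partition with the given heights outside `β`. -/
def ofHeights (β : YoungDiagram) (ε : ℕ) (f : ℕ → ℕ → ℕ) : Set (ℕ × ℕ × ℕ) :=
  {b | memRel β b.1 b.2.1 ∨ b.2.2 < f b.1 b.2.1 ∨ (b.2.2 < ε ∧ (b.1 = 0 ∨ b.2.1 = 0))}

theorem mem_ofHeights {β : YoungDiagram} {ε i j k : ℕ} {f : ℕ → ℕ → ℕ} :
    (i, j, k) ∈ ofHeights β ε f ↔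
      memRel β i j ∨ k < f i j ∨ (k < ε ∧ (i = 0 ∨ j = 0)) := Iff.rfl

open Classical in
/-- The number of boxes on the axes, in the square of size `N + 1`, outside `β`. -/
noncomputable def axisCount (β : YoungDiagram) (N : ℕ) : ℕ :=
  ∑ a ∈ range (N + 1), ∑ b ∈ range (N + 1), if ¬ memRel β a b ∧ (a = 0 ∨ b = 0) then 1 else 0

section

variable {β : YoungDiagram} {N ε : ℕ}

theorem IsSkewPP.anti {B : ℕ → ℕ → Prop} {M : ℕ} {f : ℕ → ℕ → ℕ} (hB : LowerPred B)
    (hf : IsSkewPP B M f) {i j i' j' : ℕ} (h : ¬ B i' j') (hi : i' ≤ i) (hj : j' ≤ j) :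
    f i j ≤ f i' j' := by
  obtain ⟨a, rfl⟩ := Nat.exists_eq_add_of_le hi
  obtain ⟨b, rfl⟩ := Nat.exists_eq_add_of_le hj
  have h1 : ∀ b, f i' (j' + b) ≤ f i' j' := by
    intro b
    induction b with
    | zero => exact le_rfl
    | succ b ih =>
      exact (hf.2 i' (j' + b) fun h' => h (hB _ _ _ _ le_rfl (by omega) h')).2.trans ih
  refine le_trans ?_ (h1 b)
  clear hi
  induction a with
  | zero => exact le_rfl
  | succ a ih =>
    exact (hf.2 (i' + a) (j' + b) fun h' => h (hB _ _ _ _ (by omega) (by omega) h')).1.trans ih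

theorem isLowerSet_ofHeights {f : ℕ → ℕ → ℕ} {M : ℕ} (hf : IsSkewPP (memRel β) M f) :
    IsLowerSet (ofHeights β ε f) := by
  rintro ⟨i, j, k⟩ ⟨i', j', k'⟩ ⟨hi, hj, hk⟩ h
  dsimp only at hi hj hk
  rw [mem_ofHeights] at *
  by_cases h' : memRel β i' j'
  · exact Or.inl h'
  · rcases h with h | h | h
    · exact Or.inl (lowerPred_memRel β _ _ _ _ hi hj h)
    · have := hf.anti (lowerPred_memRel β) h' hi hj
      exact Or.inr (Or.inl (by omega))
    · exact Or.inr (Or.inr (by omega))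

theorem IsSkewPP.le_of_axis {f : ℕ → ℕ → ℕ} (hf : IsSkewPP (memRel β) (N + 1) f)
    (h1 : f N 0 = ε) (h2 : f 0 N = ε) {i j : ℕ} (hi : i ≤ N) (hj : j ≤ N) (h : ¬ memRel β i j)
    (hij : i = 0 ∨ j = 0) : ε ≤ f i j := by
  rcases hij with rfl | rfl
  · rw [← h2]; exact hf.anti (lowerPred_memRel β) h le_rfl hj
  · rw [← h1]; exact hf.anti (lowerPred_memRel β) h hi le_rfl

-- Outside `β`, a column over an axis has its lowest `ε` boxes in the legs and any other column has
-- none, which explains the correction `ε * axisCount β N`.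
open Classical in
theorem exists_encard_ofHeights {f : ℕ → ℕ → ℕ} (hf : IsSkewPP (memRel β) (N + 1) f)
    (h1 : f N 0 = ε) (h2 : f 0 N = ε) : ∃ n : ℕ,
      (ofHeights β ε f \ axisLegs β ε).encard = n ∧
        ∑ a ∈ range (N + 1), ∑ b ∈ range (N + 1), f a b = n + ε * axisCount β N := by
  let T : Finset (ℕ × ℕ × ℕ) := ((range (N + 1) ×ˢ range (N + 1)).sigma fun c =>
    Ico (if c.1 = 0 ∨ c.2 = 0 then ε else 0) (f c.1 c.2)).map
      ⟨fun x => (x.1.1, x.1.2, x.2), by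
        rintro ⟨⟨a, b⟩, c⟩ ⟨⟨a', b'⟩, c'⟩ h
        simp at h
        obtain ⟨rfl, rfl, rfl⟩ := h
        rfl⟩
  refine ⟨T.card, ?_, ?_⟩
  · rw [← Set.encard_coe_eq_coe_finsetCard]
    congr 1
    ext ⟨i, j, k⟩
    simp only [Set.mem_sdiff, mem_ofHeights, mem_axisLegs, T, Finset.coe_map, Set.mem_image,
      Finset.mem_coe, Finset.mem_sigma, Finset.mem_product, Finset.mem_range, Finset.mem_Ico,
      Sigma.exists, Prod.exists]
    constructor
    · rintro ⟨h, h'⟩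
      push Not at h'
      have hk : k < f i j := by tauto
      have hz := hf.1 i j
      refine ⟨i, j, k, ⟨⟨?_, ?_⟩, ?_, hk⟩, rfl⟩
      · by_contra hi
        rw [hz (by omega)] at hk
        omega
      · by_contra hi
        rw [hz (by omega)] at hk
        omega
      · split_ifs with hax
        · by_contra hlt
          have := h'.2 (by omega)
          omega
        · omega
    · rintro ⟨i', j', k', ⟨⟨hi, hj⟩, h, hk⟩, he⟩
      obtain ⟨rfl, rfl, rfl⟩ : i' = i ∧ j' = j ∧ k' = k := by
        have he' : (i', j', k') = (i, j, k) := he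
        simpa using he'
      refine ⟨Or.inr (Or.inl hk), ?_⟩
      rintro (h' | ⟨h', hax⟩)
      · rw [hf.1 _ _ (Or.inl h')] at hk
        omega
      · rw [if_pos hax] at h
        omega
  · simp only [T, Finset.card_map, Finset.card_sigma, Nat.card_Ico, Finset.sum_product, axisCount,
      Finset.mul_sum, ← Finset.sum_add_distrib]
    refine Finset.sum_congr rfl fun a ha => Finset.sum_congr rfl fun b hb => ?_
    rw [Finset.mem_range] at ha hb
    by_cases h : memRel β a b
    · simp [h, hf.1 a b (Or.inl h)]
    · by_cases hax : a = 0 ∨ b = 0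
      · have := hf.le_of_axis h1 h2 (by omega) (by omega) h hax
        simp [h, hax]
        omega
      · simp [h, hax]

/-- A box of a 3D partition outside the legs lies near the origin. -/
theorem lt_of_mem_diff {π : Set (ℕ × ℕ × ℕ)} {n : ℕ} (hπ : IsLowerSet π)
    (hn : (π \ axisLegs β ε).encard = n) (hr : β.rowLen 0 + n < N) (hc : β.colLen 0 + n < N)
    {i j k : ℕ} (h : (i, j, k) ∈ π) (hk : ¬ (k < ε ∧ (i = 0 ∨ j = 0))) :
    i < N ∧ j < N := by
  -- Pigeonhole: a box too far out forces, by going back towards `β`, a run of `n + 1` boxes of `π`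
  -- outside the legs.
  have key : ∀ g : ℕ → ℕ × ℕ × ℕ, Set.InjOn g (range (n + 1)) →
      (∀ t < n + 1, g t ∈ π \ axisLegs β ε) → False := by
    intro g hg hm
    have h1 : (((range (n + 1)).image g : Finset _) : Set (ℕ × ℕ × ℕ)) ⊆ π \ axisLegs β ε := by
      intro x hx
      simp only [Finset.coe_image, Set.mem_image, Finset.mem_coe, Finset.mem_range] at hx
      obtain ⟨t, ht, rfl⟩ := hx
      exact hm t ht
    have h2 := Set.encard_le_encard h1
    rw [hn, Set.encard_coe_eq_coe_finsetCard, Finset.card_image_of_injOn hg, Finset.card_range] at h2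
    have h3 : n + 1 ≤ n := by exact_mod_cast h2
    omega
  constructor
  · by_contra hi
    refine key (fun t => (N - t, j, k)) ?_ fun t ht => ⟨?_, ?_⟩
    · intro a ha b hb hab
      simp at ha hb hab
      omega
    · exact hπ (a := (i, j, k)) ⟨by dsimp only; omega, le_rfl, le_rfl⟩ h
    · rw [mem_axisLegs]
      rintro (hm | hm)
      · have := YoungDiagram.mem_iff_lt_colLen.1 hm
        have := β.colLen_anti 0 j (Nat.zero_le _)
        omega
      · omega
  · by_contra hj
    refine key (fun t => (i, N - t, k)) ?_ fun t ht => ⟨?_, ?_⟩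
    · intro a ha b hb hab
      simp at ha hb hab
      omega
    · exact hπ (a := (i, j, k)) ⟨le_rfl, by dsimp only; omega, le_rfl⟩ h
    · rw [mem_axisLegs]
      rintro (hm | hm)
      · have := YoungDiagram.mem_iff_lt_rowLen.1 hm
        have := β.rowLen_anti 0 i (Nat.zero_le _)
        omega
      · omega

theorem exists_height {π : Set (ℕ × ℕ × ℕ)} {n : ℕ} (hπ : IsLowerSet π)
    (hn : (π \ axisLegs β ε).encard = n) {i j : ℕ} (h' : ¬ memRel β i j) :
    ∃ h, ∀ k, (i, j, k) ∈ π ↔ k < h := by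
  classical
  have hfin : (π \ axisLegs β ε).Finite := Set.finite_of_encard_eq_coe hn
  have hex : ∃ k, (i, j, k) ∉ π := by
    by_contra! hall
    refine Set.infinite_of_injective_forall_mem (f := fun k : ℕ => (i, j, k + ε)) ?_ ?_ hfin
    · intro a b hab
      simpa using hab
    · refine fun k => ⟨hall _, ?_⟩
      rw [mem_axisLegs]
      rintro (hm | hm)
      · exact h' hm
      · omega
  refine ⟨Nat.find hex, fun k => ⟨fun hk => ?_, fun hk => ?_⟩⟩
  · by_contra hle
    exact Nat.find_spec hex (hπ (a := (i, j, k)) ⟨le_rfl, le_rfl, not_lt.1 hle⟩ hk)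
  · by_contra hk'
    exact Nat.find_min hex hk hk'

/-- A 3D partition is determined by its heights outside `β`. The `n` extra boxes cannot reach
distance `N`, so the heights at both ends are exactly `ε`. -/
theorem ncard_axisLegs_eq {n : ℕ} (hr : β.rowLen 0 + n < N) (hc : β.colLen 0 + n < N) :
    {π | IsLowerSet π ∧ axisLegs β ε ⊆ π ∧ (π \ axisLegs β ε).encard = n}.ncard =
      edgeCount β N ε (n + ε * axisCount β N) := by
  classical
  symm
  refine Set.ncard_congr (fun f _ => ofHeights β ε f) ?_ ?_ ?_
  · rintro f ⟨hf, ⟨h1, h2⟩, h3⟩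
    refine ⟨isLowerSet_ofHeights hf, ?_, ?_⟩
    · rintro ⟨i, j, k⟩ h
      rw [mem_axisLegs] at h
      rw [mem_ofHeights]
      tauto
    · obtain ⟨m, hm, hm'⟩ := exists_encard_ofHeights hf h1 h2
      rw [hm]
      congr 1
      omega
  · rintro f g ⟨hf, ⟨h1, h2⟩, -⟩ ⟨hg, ⟨h1', h2'⟩, -⟩ h
    ext i j
    by_cases hz : memRel β i j ∨ N + 1 ≤ i ∨ N + 1 ≤ j
    · rw [hf.1 _ _ hz, hg.1 _ _ hz]
    · push Not at hz
      have hk : ∀ k, k < f i j ↔ k < g i j := by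
        intro k
        have := Set.ext_iff.1 h (i, j, k)
        rw [mem_ofHeights, mem_ofHeights] at this
        have e1 := hf.le_of_axis h1 h2 (by omega : i ≤ N) (by omega) hz.1
        have e2 := hg.le_of_axis h1' h2' (by omega : i ≤ N) (by omega) hz.1
        have e3 := hz.1
        constructor
        · intro hk
          rcases this.1 (Or.inr (Or.inl hk)) with h | h | h
          · exact absurd h e3
          · exact h
          · exact h.1.trans_le (e2 h.2)
        · intro hk
          rcases this.2 (Or.inr (Or.inl hk)) with h | h | h
          · exact absurd h e3
          · exact h
          · exact h.1.trans_le (e1 h.2)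
      have ha := hk (f i j)
      have hb := hk (g i j)
      omega
  · rintro π ⟨hπ, hL, hn⟩
    have hH : ∀ i j, ∃ h, ¬ memRel β i j → ∀ k, (i, j, k) ∈ π ↔ k < h := by
      intro i j
      by_cases hm : memRel β i j
      · exact ⟨0, fun h => absurd hm h⟩
      · obtain ⟨h, hh⟩ := exists_height hπ hn hm
        exact ⟨h, fun _ => hh⟩
    choose H hH using hH
    set f : ℕ → ℕ → ℕ := fun i j => if memRel β i j ∨ N + 1 ≤ i ∨ N + 1 ≤ j then 0 else H i j
      with hfdef
    have hlt : ∀ {i j k}, (i, j, k) ∈ π → ¬ (k < ε ∧ (i = 0 ∨ j = 0)) →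
      i < N ∧ j < N := fun h hk => lt_of_mem_diff hπ hn hr hc h hk
    have hf : IsSkewPP (memRel β) (N + 1) f := by
      refine ⟨fun i j h => if_pos h, fun i j h => ?_⟩
      have h1 : ∀ i' j', i ≤ i' → j ≤ j' → f i' j' ≤ f i j := by
        intro i' j' hi hj
        by_cases hz : N + 1 ≤ i' ∨ N + 1 ≤ j'
        · have : f i' j' = 0 := if_pos (Or.inr hz)
          omega
        · have hm' : ¬ memRel β i' j' := fun h' => h (lowerPred_memRel β _ _ _ _ hi hj h')
          have e1 : f i' j' = H i' j' := if_neg (by tauto)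
          have e2 : f i j = H i j := if_neg (by
            rintro (h' | h')
            · exact h h'
            · omega)
          rw [e1, e2]
          by_contra! hlt
          have := hπ (a := (i', j', H i j)) (b := (i, j, H i j)) ⟨hi, hj, le_rfl⟩
            ((hH i' j' hm' _).2 hlt)
          have := (hH i j h _).1 this
          omega
      exact ⟨h1 _ _ (by omega) le_rfl, h1 _ _ le_rfl (by omega)⟩
    -- A larger height would put a box outside the legs at distance `N`, against `hlt`; a smaller
    -- one would miss a box of the legs.
    have hend : ∀ i j, ¬ memRel β i j → i ≤ N → j ≤ N → (i = N ∨ j = N) → (i = 0 ∨ j = 0) →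
        f i j = ε := by
      intro i j hm hi hj hN hax
      have e1 : f i j = H i j := if_neg (by
        rintro (h' | h')
        · exact hm h'
        · omega)
      rw [e1]
      have e2 := hH i j hm
      refine le_antisymm ?_ ?_
      · by_contra! hlt'
        have := hlt ((e2 ε).2 hlt') (by omega)
        omega
      · by_contra! hlt'
        have := (e2 (H i j)).1 (hL (mem_axisLegs.2 (Or.inr ⟨hlt', hax⟩)))
        omega
    have h1 : f N 0 = ε := hend N 0 (not_memRel_iff'.2 (by omega)) le_rfl (by omega) (Or.inl rfl)
      (Or.inr rfl)
    have h2 : f 0 N = ε := hend 0 N (not_memRel_iff.2 (by omega)) (by omega) le_rfl (Or.inr rfl)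
      (Or.inl rfl)
    have heq : ofHeights β ε f = π := by
      ext ⟨i, j, k⟩
      rw [mem_ofHeights]
      by_cases hm : memRel β i j
      · exact ⟨fun _ => hL (mem_axisLegs.2 (Or.inl hm)), fun _ => Or.inl hm⟩
      · by_cases hz : N + 1 ≤ i ∨ N + 1 ≤ j
        · have e1 : f i j = 0 := if_pos (Or.inr hz)
          constructor
          · rintro (h | h | h)
            · exact absurd h hm
            · omega
            · exact hL (mem_axisLegs.2 (Or.inr h))
          · intro h
            right; right
            by_contra h'
            have := hlt h h'
            omega
        · have e1 : f i j = H i j := if_neg (by tauto)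
          rw [e1, ← hH i j hm]
          constructor
          · rintro (h | h | h)
            · exact absurd h hm
            · exact h
            · exact hL (mem_axisLegs.2 (Or.inr h))
          · exact fun h => Or.inr (Or.inl h)
    refine ⟨f, ⟨hf, ⟨h1, h2⟩, ?_⟩, heq⟩
    obtain ⟨m, hm, hm'⟩ := exists_encard_ofHeights hf h1 h2
    rw [heq, hn] at hm
    have : n = m := by exact_mod_cast hm
    omega

end

theorem ncard_partitions3D_bot {β : YoungDiagram} {N n : ℕ} (hr : β.rowLen 0 + n < N)
    (hc : β.colLen 0 + n < N) : (partitions3D ⊥ ⊥ β n).ncard = edgeCount β N 0 n := by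
  have := ncard_axisLegs_eq (ε := 0) hr hc
  rwa [zero_mul, add_zero, ← legs_bot_bot] at this

theorem ncard_partitions3D_box {β : YoungDiagram} {N n : ℕ} (hr : β.rowLen 0 + n < N)
    (hc : β.colLen 0 + n < N) :
    (partitions3D box box β n).ncard = edgeCount β N 1 (n + axisCount β N) := by
  have := ncard_axisLegs_eq (ε := 1) hr hc
  rwa [one_mul, ← legs_box_box] at this

/-! ### Exponents and the ratio of the two vertices. -/

/-- The number of boxes of `β` on the axes. -/
def axisCells (β : YoungDiagram) : ℕ := (β.cells.filter fun c => c.1 = 0 ∨ c.2 = 0).card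

theorem axisCount_add {β : YoungDiagram} {N : ℕ} (hr : β.rowLen 0 ≤ N) (hc : β.colLen 0 ≤ N) :
    axisCount β N + axisCells β = 2 * N + 1 := by
  classical
  have h1 : axisCells β = ∑ a ∈ range (N + 1), ∑ b ∈ range (N + 1),
      if memRel β a b ∧ (a = 0 ∨ b = 0) then 1 else 0 := by
    rw [← Finset.sum_product', ← Finset.card_filter, axisCells]
    congr 1
    ext ⟨a, b⟩
    simp only [mem_filter, mem_product, mem_range, YoungDiagram.mem_cells]
    constructor
    · rintro ⟨h, hax⟩
      have h2 := YoungDiagram.mem_iff_lt_rowLen.1 h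
      have h3 := YoungDiagram.mem_iff_lt_colLen.1 h
      have := β.rowLen_anti 0 a (Nat.zero_le _)
      have := β.colLen_anti 0 b (Nat.zero_le _)
      exact ⟨⟨by omega, by omega⟩, h, hax⟩
    · exact fun h => h.2
  have h2 : ∀ a b, (if ¬ memRel β a b ∧ (a = 0 ∨ b = 0) then 1 else 0) +
      (if memRel β a b ∧ (a = 0 ∨ b = 0) then 1 else 0) = if a = 0 ∨ b = 0 then 1 else 0 := by
    intro a b
    by_cases h : memRel β a b <;> simp [h]
  rw [h1, axisCount]
  simp_rw [← Finset.sum_add_distrib, h2]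
  rw [Finset.sum_range_succ']
  simp_rw [Finset.sum_range_succ' _ N]
  simp
  omega

theorem overlap_bot_bot (β : YoungDiagram) : overlap ⊥ ⊥ β = 0 := by
  simp [overlap, leg₁, leg₂]

/-- The two one-box legs meet only at the origin, and their union meets the third leg in the axis
boxes of `β` at height 0. -/
theorem overlap_box_box (β : YoungDiagram) : overlap box box β = 1 + axisCells β := by
  unfold overlap
  congr 1
  · rw [Set.ncard_eq_one]
    refine ⟨(0, 0, 0), ?_⟩
    ext ⟨i, j, k⟩
    simp only [leg₁, leg₂, mem_box, Set.mem_inter_iff, Set.mem_ofPred_eq, Prod.mk.injEq,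
      Set.mem_singleton_iff]
    tauto
  · rw [axisCells, ← Set.ncard_coe_finset]
    symm
    refine Set.ncard_congr (fun c _ => (c.1, c.2, 0)) ?_ ?_ ?_
    · rintro ⟨i, j⟩ h
      simp only [Finset.coe_filter, YoungDiagram.mem_cells, Set.mem_ofPred_eq] at h
      simp only [leg₁, leg₂, leg₃, mem_box, Set.mem_inter_iff, Set.mem_union, Set.mem_ofPred_eq,
        Prod.mk.injEq]
      tauto
    · rintro ⟨i, j⟩ ⟨i', j'⟩ _ _ h
      simpa using h
    · rintro ⟨i, j, k⟩ h
      simp only [leg₁, leg₂, leg₃, mem_box, Set.mem_inter_iff, Set.mem_union, Set.mem_ofPred_eq,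
        Prod.mk.injEq] at h
      refine ⟨(i, j), ?_, ?_⟩
      · simp only [Finset.coe_filter, YoungDiagram.mem_cells, Set.mem_ofPred_eq]
        tauto
      · simp
        omega

/-- The exponent attached to a row and a column of `β`. -/
def hookExp (β : YoungDiagram) (i j : ℕ) : ℤ := i + j + 1 - β.rowLen i - β.colLen j

/-- The first row and first column share at most one box; the inequality is strict for empty `β`. -/
theorem axisCells_add_one (β : YoungDiagram) : β.rowLen 0 + β.colLen 0 ≤ axisCells β + 1 := by
  have h1 := Finset.card_union_add_card_inter (β.row 0) (β.col 0)
  have h2 : (β.row 0 ∩ β.col 0).card ≤ 1 := by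
    rw [Finset.card_le_one]
    rintro ⟨a, b⟩ h ⟨a', b'⟩ h'
    simp only [Finset.mem_inter, YoungDiagram.mem_row_iff, YoungDiagram.mem_col_iff] at h h'
    ext
    · exact h.1.2.trans h'.1.2.symm
    · exact h.2.2.trans h'.2.2.symm
  have h3 : (β.row 0 ∪ β.col 0).card ≤ axisCells β := by
    refine Finset.card_le_card ?_
    rintro ⟨a, b⟩ h
    simp only [Finset.mem_union, YoungDiagram.mem_row_iff, YoungDiagram.mem_col_iff,
      Finset.mem_filter, YoungDiagram.mem_cells] at h ⊢
    tauto
  rw [β.rowLen_eq_card, β.colLen_eq_card]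
  omega

/-- The exponent attached to an edge filling. -/
def edgeExp (β : YoungDiagram) (N : ℕ) : Option (Fin N × Fin N) → ℤ
  | none => 0
  | some (i, j) => hookExp β i j

/-- Up to `edgeExp`, the weight is `2 * N + 1 = axisCount β N + axisCells β`. The term `axisCount β
N` cancels against the boxes of the legs, so the exponents do not depend on `N`. -/
theorem edgeWeight_eq {β : YoungDiagram} {N : ℕ} (hr : β.rowLen 0 ≤ N) (hc : β.colLen 0 ≤ N)
    (κ : Option (Fin N × Fin N)) :
    (edgeWeight β N κ : ℤ) = axisCount β N + axisCells β + edgeExp β N κ := by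
  have h := axisCount_add hr hc
  rcases κ with _ | ⟨i, j⟩
  · have h1 := outerHook_add (not_memRel_iff.2 (by rw [rowLen_eq_zero hc le_rfl]; omega) :
      ¬ memRel β N N)
    rw [rowLen_eq_zero hc le_rfl, colLen_eq_zero hr le_rfl] at h1
    simp only [edgeWeight, edgeExp]
    omega
  · have h1 := outerHook_add (not_memRel_iff.2 ((β.rowLen_anti 0 i (Nat.zero_le _)).trans hr))
    have h2 := outerHook_add (not_memRel_iff'.2 ((β.colLen_anti 0 j (Nat.zero_le _)).trans hc))
    rw [colLen_eq_zero hr le_rfl] at h1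
    rw [rowLen_eq_zero hc le_rfl] at h2
    simp only [edgeWeight, edgeExp, hookExp]
    push_cast
    omega

theorem edgeExp_add_nonneg (β : YoungDiagram) (N : ℕ) (κ : Option (Fin N × Fin N)) :
    0 ≤ edgeExp β N κ + axisCells β := by
  rcases κ with _ | ⟨i, j⟩
  · simp [edgeExp]
  · have := axisCells_add_one β
    have := β.rowLen_anti 0 i (Nat.zero_le _)
    have := β.colLen_anti 0 j (Nat.zero_le _)
    simp only [edgeExp, hookExp]
    omega

theorem isLowerSet_axisLegs (β : YoungDiagram) (ε : ℕ) : IsLowerSet (axisLegs β ε) := by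
  rintro ⟨i, j, k⟩ ⟨i', j', k'⟩ ⟨hi, hj, hk⟩ h
  dsimp only at hi hj hk
  rw [mem_axisLegs] at *
  rcases h with h | h
  · exact Or.inl (lowerPred_memRel β _ _ _ _ hi hj h)
  · exact Or.inr (by omega)

theorem ncard_partitions3D_zero (β : YoungDiagram) : (partitions3D ⊥ ⊥ β 0).ncard = 1 := by
  rw [Set.ncard_eq_one]
  refine ⟨axisLegs β 0, ?_⟩
  ext π
  simp only [partitions3D, legs_bot_bot, Set.mem_ofPred_eq, Set.mem_singleton_iff, Nat.cast_zero,
    Set.encard_eq_zero, Set.sdiff_eq_empty]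
  constructor
  · exact fun h => Set.Subset.antisymm h.2.2 h.2.1
  · rintro rfl
    exact ⟨isLowerSet_axisLegs β 0, subset_rfl, subset_rfl⟩

/-- The generating series of 3D partitions by the number of boxes outside the legs. -/
noncomputable def vertexSeries (μ₁ μ₂ μ₃ : YoungDiagram) : PowerSeries ℚ :=
  PowerSeries.mk fun n => ((partitions3D μ₁ μ₂ μ₃ n).ncard : ℚ)

/-- `edgeCount_one` as a product of series. The second factor is truncated at `N`, so the identity
is asserted only for degrees `n` small against `N`. -/
theorem coeff_vertexSeries_box {β : YoungDiagram} {N n : ℕ} (hr : β.rowLen 0 + n < N)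
    (hc : β.colLen 0 + n < N) : PowerSeries.coeff n (vertexSeries box box β) =
      PowerSeries.coeff n (vertexSeries ⊥ ⊥ β *
        ∑ κ, PowerSeries.X ^ (edgeExp β N κ + axisCells β).toNat) := by
  rw [Finset.mul_sum, map_sum, vertexSeries, PowerSeries.coeff_mk, ncard_partitions3D_box hr hc,
    edgeCount_one (by omega) (by omega), Nat.cast_sum]
  refine Finset.sum_congr rfl fun κ _ => ?_
  have h1 := edgeWeight_eq (by omega) (by omega) κ (β := β)
  have h2 := edgeExp_add_nonneg β N κ
  rw [PowerSeries.coeff_mul_X_pow']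
  by_cases h : edgeWeight β N κ ≤ n + axisCount β N
  · rw [if_pos h, if_pos (by omega), vertexSeries, PowerSeries.coeff_mk,
      ncard_partitions3D_bot (N := N) (by omega) (by omega)]
    congr 2
    omega
  · rw [if_neg h, if_neg (by omega), Nat.cast_zero]

theorem vertexSeries_bot_inv (β : YoungDiagram) :
    vertexSeries ⊥ ⊥ β * (vertexSeries ⊥ ⊥ β)⁻¹ = 1 := by
  refine PowerSeries.mul_inv_cancel _ ?_
  rw [← PowerSeries.coeff_zero_eq_constantCoeff_apply, vertexSeries, PowerSeries.coeff_mk,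
    ncard_partitions3D_zero]
  simp

/-- The congruence modulo `X ^ (n + 1)` survives multiplication by the inverse series. -/
theorem coeff_vertexSeries_ratio {β : YoungDiagram} {N n : ℕ} (hr : β.rowLen 0 + n < N)
    (hc : β.colLen 0 + n < N) :
    PowerSeries.coeff n (vertexSeries box box β * (vertexSeries ⊥ ⊥ β)⁻¹) =
      ((univ.filter fun κ => edgeExp β N κ + axisCells β = n).card : ℚ) := by
  set Q : PowerSeries ℚ := ∑ κ, PowerSeries.X ^ (edgeExp β N κ + axisCells β).toNat with hQ
  have h1 : (PowerSeries.X : PowerSeries ℚ) ^ (n + 1) ∣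
      vertexSeries box box β - vertexSeries ⊥ ⊥ β * Q := by
    rw [PowerSeries.X_pow_dvd_iff]
    intro m hm
    rw [map_sub, coeff_vertexSeries_box (N := N) (by omega) (by omega), sub_self]
  have h2 : vertexSeries box box β * (vertexSeries ⊥ ⊥ β)⁻¹ = Q +
      (vertexSeries box box β - vertexSeries ⊥ ⊥ β * Q) * (vertexSeries ⊥ ⊥ β)⁻¹ := by
    linear_combination Q * vertexSeries_bot_inv β
  have h3 := PowerSeries.X_pow_dvd_iff.1 (h1.mul_right (vertexSeries ⊥ ⊥ β)⁻¹) n (by omega)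
  rw [h2, map_add, h3, add_zero, hQ, map_sum, Finset.card_filter, Nat.cast_sum]
  refine Finset.sum_congr rfl fun κ _ => ?_
  have := edgeExp_add_nonneg β N κ
  rw [PowerSeries.coeff_X_pow]
  by_cases h : edgeExp β N κ + axisCells β = n
  · rw [if_pos (by omega), if_pos h, Nat.cast_one]
  · rw [if_neg (by omega), if_neg h, Nat.cast_zero]

theorem p_zpow (n : ℤ) : p ^ n = HahnSeries.single n 1 := by
  exact (RatFunc.single_zpow n).symm

/-- The factor `p` cancels the overlap of the two one-box legs at the origin. -/
theorem vertex_ratio_eq (β : YoungDiagram) : p * (V box box β / V ⊥ ⊥ β) =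
    HahnSeries.single (-(axisCells β : ℤ)) 1 *
      HahnSeries.ofPowerSeries ℤ ℚ (vertexSeries box box β * (vertexSeries ⊥ ⊥ β)⁻¹) := by
  have h1 := congrArg (HahnSeries.ofPowerSeries ℤ ℚ) (vertexSeries_bot_inv β)
  rw [map_mul, map_one] at h1
  have hV : V ⊥ ⊥ β = HahnSeries.ofPowerSeries ℤ ℚ (vertexSeries ⊥ ⊥ β) := by
    simp [V, overlap_bot_bot, vertexSeries]
  have hV' : V box box β = p ^ (-(1 + axisCells β : ℤ)) *
      HahnSeries.ofPowerSeries ℤ ℚ (vertexSeries box box β) := by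
    simp [V, overlap_box_box, vertexSeries]
  have hp : p ≠ 0 := HahnSeries.single_ne_zero one_ne_zero
  have h2 : p * p ^ (-(1 + axisCells β : ℤ)) = HahnSeries.single (-(axisCells β : ℤ)) 1 := by
    rw [← p_zpow, ← zpow_one_add₀ hp]
    congr 1
    ring
  rw [hV, hV', map_mul, ← h2, div_eq_mul_inv, ← eq_inv_of_mul_eq_one_right h1]
  ring

/-- The coefficients of `p * V_{(1)(1)β} / V_{∅∅β}`. -/
theorem coeff_vertex_ratio {β : YoungDiagram} {N : ℕ} {x : ℤ}
    (hr : (β.rowLen 0 : ℤ) + (axisCells β + x) < N) (hc : (β.colLen 0 : ℤ) + (axisCells β + x) < N) :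
    (p * (V box box β / V ⊥ ⊥ β)).coeff x = (if x = 0 then 1 else 0) +
      (((range N ×ˢ range N).filter fun c => hookExp β c.1 c.2 = x).card : ℚ) := by
  have h1 : (p * (V box box β / V ⊥ ⊥ β)).coeff x =
      ((univ.filter fun κ => edgeExp β N κ = x).card : ℚ) := by
    rw [vertex_ratio_eq]
    obtain ⟨y, rfl⟩ : ∃ y, x = y + -(axisCells β : ℤ) := ⟨x + axisCells β, by ring⟩
    rw [HahnSeries.coeff_single_mul_add, one_mul]
    -- For `y < 0` both sides vanish, since every `edgeExp` is at least `-axisCells β`.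
    rcases lt_or_ge y 0 with hy | hy
    · rw [HahnSeries.ofPowerSeries_apply, HahnSeries.embDomain_of_notMem_range,
        Finset.card_eq_zero.2, Nat.cast_zero]
      · rw [Finset.filter_eq_empty_iff]
        intro κ _ hκ
        have := edgeExp_add_nonneg β N κ
        omega
      · rintro ⟨n, hn⟩
        simp at hn
        omega
    · lift y to ℕ using hy
      rw [HahnSeries.ofPowerSeries_apply_coeff,
        coeff_vertexSeries_ratio (N := N) (by omega) (by omega)]
      congr 3
      ext κ
      omega
  have h2 : (univ.filter fun κ => edgeExp β N κ = x).card = (if x = 0 then 1 else 0) +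
      ((range N ×ˢ range N).filter fun c => hookExp β c.1 c.2 = x).card := by
    rw [Finset.card_filter, Fintype.sum_option, Finset.card_filter, Finset.sum_product,
      Fintype.sum_prod_type]
    simp only [Finset.sum_range]
    congr 1
    exact if_congr eq_comm rfl rfl
  rw [h1, h2, Nat.cast_add]
  congr 1
  split_ifs <;> simp

/-! ### Beta sets of partitions. -/

/-- The set of first-column hook lengths of `β`, padded to `N` rows. -/
def betaSet (β : YoungDiagram) (N : ℕ) : Finset ℕ :=
  (range N).image fun i => β.rowLen i + (N - 1 - i)

theorem mem_betaSet {β : YoungDiagram} {N a : ℕ} :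
    a ∈ betaSet β N ↔ ∃ i < N, β.rowLen i + (N - 1 - i) = a := by simp [betaSet]

theorem betaSet_injOn (β : YoungDiagram) (N : ℕ) :
    Set.InjOn (fun i => β.rowLen i + (N - 1 - i)) (range N) := by
  intro i hi j hj h
  simp only [coe_range, Set.mem_Iio] at hi hj
  dsimp only at h
  rcases lt_trichotomy i j with hij | hij | hij
  · have := β.rowLen_anti i j hij.le
    omega
  · exact hij
  · have := β.rowLen_anti j i hij.le
    omega

theorem card_betaSet (β : YoungDiagram) (N : ℕ) : (betaSet β N).card = N := by
  rw [betaSet, Finset.card_image_of_injOn (betaSet_injOn β N), card_range]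

theorem sum_rowLen {β : YoungDiagram} {N : ℕ} (hc : β.colLen 0 ≤ N) :
    ∑ i ∈ range N, β.rowLen i = β.card := by
  have h : ∀ c ∈ β.cells, c.1 ∈ range N := by
    rintro ⟨i, j⟩ h
    have := YoungDiagram.mem_iff_lt_colLen.1 h
    have := β.colLen_anti 0 j (Nat.zero_le _)
    simp only [mem_range]
    omega
  rw [YoungDiagram.card, Finset.card_eq_sum_card_fiberwise h]
  refine Finset.sum_congr rfl fun i _ => ?_
  rw [YoungDiagram.rowLen_eq_card]
  rfl

theorem sum_betaSet {β : YoungDiagram} {N : ℕ} (hc : β.colLen 0 ≤ N) :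
    ∑ a ∈ betaSet β N, a = β.card + ∑ i ∈ range N, i := by
  rw [betaSet, Finset.sum_image (betaSet_injOn β N), Finset.sum_add_distrib, sum_rowLen hc,
    Finset.sum_range_reflect (fun i => i)]

/-- Beads decrease with the row index, so sorting the set recovers the row lengths. -/
theorem betaSet_orderEmb {β : YoungDiagram} {N : ℕ} {X : Finset ℕ} (hX : X.card = N)
    (h : betaSet β N = X) (i : Fin N) :
    X.orderEmbOfFin hX i = β.rowLen (N - 1 - i) + i := by
  have h1 := Finset.orderEmbOfFin_unique hX (f := fun i : Fin N => β.rowLen (N - 1 - i) + i)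
    (fun i => by
      rw [← h, mem_betaSet]
      have := i.2
      exact ⟨N - 1 - i, by omega, by omega⟩)
    (fun i j hij => by
      have := β.rowLen_anti (N - 1 - j) (N - 1 - i) (by omega)
      have : (i : ℕ) < j := hij
      dsimp only
      omega)
  exact (congrFun h1 i).symm

theorem rowLen_le_card (β : YoungDiagram) : β.rowLen 0 ≤ β.card := by
  rw [YoungDiagram.rowLen_eq_card]
  exact Finset.card_le_card (Finset.filter_subset _ _)

theorem colLen_le_card (β : YoungDiagram) : β.colLen 0 ≤ β.card := by
  rw [YoungDiagram.colLen_eq_card]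
  exact Finset.card_le_card (Finset.filter_subset _ _)

theorem axisCells_le_card (β : YoungDiagram) : axisCells β ≤ β.card :=
  Finset.card_le_card (Finset.filter_subset _ _)

/-- The sets of `N` natural numbers whose sum exceeds the least possible one by `d`. -/
def shiftedSets (N d : ℕ) : Finset (Finset ℕ) :=
  (range (d + ∑ i ∈ range N, i + 1)).powerset.filter fun X =>
    X.card = N ∧ ∑ a ∈ X, a = d + ∑ i ∈ range N, i

theorem mem_shiftedSets {N d : ℕ} {X : Finset ℕ} :
    X ∈ shiftedSets N d ↔ X.card = N ∧ ∑ a ∈ X, a = d + ∑ i ∈ range N, i := by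
  simp only [shiftedSets, mem_filter, mem_powerset, and_iff_right_iff_imp]
  rintro ⟨-, h⟩ a ha
  have := Finset.single_le_sum (f := fun a => a) (fun _ _ => Nat.zero_le _) ha
  rw [mem_range]
  omega

theorem mem_partitionsOfSize {d : ℕ} {β : YoungDiagram} :
    β ∈ partitionsOfSize d ↔ β.card = d := by simp [partitionsOfSize]

theorem StrictMono.add_sub_le {N : ℕ} {f : Fin N → ℕ} (hf : StrictMono f) {i j : Fin N}
    (h : i ≤ j) : f i + (j - i) ≤ f j := by
  obtain ⟨i, hi⟩ := i
  obtain ⟨j, hj⟩ := j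
  have h : i ≤ j := h
  obtain ⟨k, rfl⟩ := Nat.exists_eq_add_of_le h
  clear h
  induction k with
  | zero => simp
  | succ k ih =>
    have h1 := ih (by omega) (by simp)
    have h2 : f ⟨i + k, by omega⟩ < f ⟨i + (k + 1), hj⟩ := hf (by simp)
    change f ⟨i, hi⟩ + (i + k - i) ≤ f ⟨i + k, _⟩ at h1
    change f ⟨i, hi⟩ + (i + (k + 1) - i) ≤ _
    omega

theorem exists_betaSet_eq {N : ℕ} {X : Finset ℕ} (hX : X.card = N) :
    ∃ β : YoungDiagram, β.colLen 0 ≤ N ∧ betaSet β N = X := by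
  set f := X.orderEmbOfFin hX with hf
  have hmono : StrictMono f := f.strictMono
  -- The row lengths forced by `betaSet_orderEmb`; strict growth of `f` makes them decrease weakly.
  let g : ℕ → ℕ := fun i => if h : i < N then f ⟨N - 1 - i, by omega⟩ - (N - 1 - i) else 0
  have hg : ∀ i j, i ≤ j → g j ≤ g i := by
    intro i j hij
    by_cases hj : j < N
    · have := StrictMono.add_sub_le hmono (i := ⟨N - 1 - j, by omega⟩) (j := ⟨N - 1 - i, by omega⟩)
        (by simp; omega)
      simp only at this
      simp only [g, dif_pos hj, dif_pos (hij.trans_lt hj)]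
      omega
    · simp [g, dif_neg hj]
  have hg0 : ∀ i, N ≤ i → g i = 0 := fun i hi => dif_neg (by omega)
  let β : YoungDiagram :=
    ⟨(range N ×ˢ range (g 0)).filter fun c => c.2 < g c.1, by
      rintro ⟨i, j⟩ ⟨i', j'⟩ ⟨hi, hj⟩ h
      dsimp only at hi hj
      simp only [Finset.coe_filter, mem_product, mem_range, Set.mem_ofPred_eq] at h ⊢
      have := hg _ _ hi
      omega⟩
  have hmem : ∀ i j, (i, j) ∈ β ↔ j < g i := by
    intro i j
    change (i, j) ∈ (range N ×ˢ range (g 0)).filter (fun c => c.2 < g c.1) ↔ _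
    simp only [mem_filter, mem_product, mem_range]
    have h1 := hg 0 i (Nat.zero_le _)
    have h2 := hg0 i
    omega
  have hrow : ∀ i, β.rowLen i = g i := fun i =>
    eq_of_forall_lt_iff fun j => by rw [← YoungDiagram.mem_iff_lt_rowLen, hmem]
  refine ⟨β, ?_, ?_⟩
  · by_contra! h
    have := YoungDiagram.mem_iff_lt_colLen.2 h
    rw [hmem, hg0 N le_rfl] at this
    omega
  · refine Finset.eq_of_subset_of_card_le ?_ (by rw [hX, card_betaSet])
    intro a ha
    obtain ⟨i, hi, rfl⟩ := mem_betaSet.1 ha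
    have h1 := StrictMono.add_sub_le hmono (i := ⟨0, by omega⟩) (j := ⟨N - 1 - i, by omega⟩)
      (by simp)
    have h2 : β.rowLen i + (N - 1 - i) = f ⟨N - 1 - i, by omega⟩ := by
      simp only at h1
      rw [hrow]
      simp only [g, dif_pos hi]
      omega
    rw [h2]
    exact Finset.orderEmbOfFin_mem _ _ _

theorem sum_partitionsOfSize {M : Type*} [AddCommMonoid M] {N d : ℕ} (hd : d ≤ N)
    (g : Finset ℕ → M) :
    ∑ β ∈ partitionsOfSize d, g (betaSet β N) = ∑ X ∈ shiftedSets N d, g X := by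
  refine Finset.sum_bij (fun β _ => betaSet β N) ?_ ?_ ?_ fun _ _ => rfl
  · intro β hβ
    rw [mem_partitionsOfSize] at hβ
    have := colLen_le_card β
    rw [mem_shiftedSets, sum_betaSet (by omega), hβ]
    exact ⟨card_betaSet β N, rfl⟩
  · intro β hβ γ hγ h
    rw [mem_partitionsOfSize] at hβ hγ
    have h1 := colLen_le_card β
    have h2 := colLen_le_card γ
    ext ⟨i, j⟩
    rw [YoungDiagram.mem_cells, YoungDiagram.mem_cells, YoungDiagram.mem_iff_lt_rowLen,
      YoungDiagram.mem_iff_lt_rowLen]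
    by_cases hi : i < N
    · have e1 := betaSet_orderEmb (card_betaSet γ N) h ⟨N - 1 - i, by omega⟩
      have e2 := betaSet_orderEmb (card_betaSet γ N) rfl ⟨N - 1 - i, by omega⟩
      rw [e1] at e2
      simp only [show N - 1 - (N - 1 - i) = i by omega] at e2
      omega
    · rw [rowLen_eq_zero (N := N) (by omega) (by omega), rowLen_eq_zero (N := N) (by omega) (by omega)]
  · intro X hX
    rw [mem_shiftedSets] at hX
    obtain ⟨β, hc, hβ⟩ := exists_betaSet_eq hX.1
    refine ⟨β, ?_, hβ⟩
    have h1 := sum_betaSet hc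
    rw [hβ] at h1
    rw [mem_partitionsOfSize]
    omega

/-! ### Moving beads by `k`. -/

/-- The elements of `X` that can be moved up by `k`. -/
def upMoves (k : ℕ) (X : Finset ℕ) : Finset ℕ := X.filter fun a => a + k ∉ X

/-- The elements of `X` that can be moved down by `k`. -/
def downMoves (k : ℕ) (X : Finset ℕ) : Finset ℕ := X.filter fun a => k ≤ a ∧ a - k ∉ X

/-- Elements blocked upwards and elements at least `k` blocked downwards are the two ends of the
pairs `a, a + k` in `X`, hence equinumerous. The `k` elements below `k` make the difference. -/
theorem card_upMoves {k : ℕ} {X : Finset ℕ} (h : range k ⊆ X) :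
    (upMoves k X).card = (downMoves k X).card + k := by
  have h1 := Finset.card_filter_add_card_filter_not (s := X) (fun a => a + k ∉ X)
  have h2 := Finset.card_filter_add_card_filter_not (s := X.filter fun a => k ≤ a)
    (fun a => a - k ∉ X)
  have h3 := Finset.card_filter_add_card_filter_not (s := X) (fun a => k ≤ a)
  have h4 : X.filter (fun a => ¬ k ≤ a) = range k := by
    ext a
    simp only [mem_filter, mem_range, not_le]
    exact ⟨fun h => h.2, fun h' => ⟨h (mem_range.2 h'), h'⟩⟩
  have h5 : (X.filter fun a => ¬ a + k ∉ X).card =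
      ((X.filter fun a => k ≤ a).filter fun a => ¬ a - k ∉ X).card := by
    refine Finset.card_bij' (fun a _ => a + k) (fun a _ => a - k) ?_ ?_ ?_ ?_
    · intro a ha
      simp only [mem_filter, not_not] at ha ⊢
      simp [ha.1, ha.2]
    · intro a ha
      simp only [mem_filter, not_not] at ha ⊢
      rw [Nat.sub_add_cancel ha.1.2]
      exact ⟨ha.2, ha.1.1⟩
    · intro a _
      simp
    · intro a ha
      simp only [mem_filter] at ha
      omega
  rw [Finset.filter_filter] at h2
  rw [h4, card_range] at h3
  unfold upMoves downMoves
  omega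

theorem move_sum {X : Finset ℕ} {a b : ℕ} (ha : a ∈ X) (hb : b ∉ X) :
    (insert b (X.erase a)).card = X.card ∧
      ∑ x ∈ insert b (X.erase a), x + a = ∑ x ∈ X, x + b := by
  have hb' : b ∉ X.erase a := fun h => hb (Finset.mem_of_mem_erase h)
  rw [Finset.card_insert_of_notMem hb', Finset.card_erase_of_mem ha, Finset.sum_insert hb']
  have h1 := Finset.card_pos.2 ⟨a, ha⟩
  have h2 := Finset.add_sum_erase X (fun x => x) ha
  omega

/-- Performing an up move raises the sum of the set by `k` and can be undone by a down move. -/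
theorem sum_upMoves {N d k : ℕ} (hk : 0 < k) :
    ∑ X ∈ shiftedSets N d, (upMoves k X).card =
      ∑ X ∈ shiftedSets N (d + k), (downMoves k X).card := by
  rw [← Finset.card_sigma, ← Finset.card_sigma]
  refine Finset.card_bij' (fun x _ => ⟨insert (x.2 + k) (x.1.erase x.2), x.2 + k⟩)
    (fun x _ => ⟨insert (x.2 - k) (x.1.erase x.2), x.2 - k⟩) ?_ ?_ ?_ ?_
  · rintro ⟨X, a⟩ h
    simp only [mem_sigma, mem_shiftedSets, upMoves, downMoves, mem_filter] at h ⊢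
    obtain ⟨⟨h1, h2⟩, h3, h4⟩ := h
    have := move_sum h3 h4
    refine ⟨⟨by omega, by omega⟩, Finset.mem_insert_self _ _, by omega, ?_⟩
    rw [Nat.add_sub_cancel, Finset.mem_insert]
    simp
    omega
  · rintro ⟨X, a⟩ h
    simp only [mem_sigma, mem_shiftedSets, upMoves, downMoves, mem_filter] at h ⊢
    obtain ⟨⟨h1, h2⟩, h3, h4, h5⟩ := h
    have := move_sum h3 h5
    refine ⟨⟨by omega, by omega⟩, Finset.mem_insert_self _ _, ?_⟩
    rw [Nat.sub_add_cancel h4, Finset.mem_insert]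
    simp
    omega
  · rintro ⟨X, a⟩ h
    simp only [mem_sigma, mem_shiftedSets, upMoves, mem_filter] at h
    simp only [Nat.add_sub_cancel]
    rw [Finset.erase_insert (fun h' => h.2.2 (Finset.mem_of_mem_erase h')),
      Finset.insert_erase h.2.1]
  · rintro ⟨X, a⟩ h
    simp only [mem_sigma, mem_shiftedSets, downMoves, mem_filter] at h
    simp only [Nat.sub_add_cancel h.2.2.1]
    rw [Finset.erase_insert (fun h' => h.2.2.2 (Finset.mem_of_mem_erase h')),
      Finset.insert_erase h.2.1]

theorem sum_range_le_sum {N : ℕ} {X : Finset ℕ} (hX : X.card = N) :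
    ∑ i ∈ range N, i ≤ ∑ a ∈ X, a := by
  obtain ⟨β, hc, rfl⟩ := exists_betaSet_eq hX
  rw [sum_betaSet hc]
  omega

/-- Such a move would bring the sum below the least possible one. -/
theorem downMoves_eq_empty {N d k : ℕ} (hk : d < k) {X : Finset ℕ} (hX : X ∈ shiftedSets N d) :
    downMoves k X = ∅ := by
  rw [downMoves, Finset.filter_eq_empty_iff]
  rintro a ha ⟨h1, h2⟩
  rw [mem_shiftedSets] at hX
  have h3 := move_sum ha h2
  have h4 := sum_range_le_sum (h3.1.trans hX.1)
  omega

section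

variable {β : YoungDiagram} {N : ℕ}

theorem range_subset_betaSet {k : ℕ} (hc : β.colLen 0 + k ≤ N) : range k ⊆ betaSet β N := by
  intro a ha
  rw [mem_range] at ha
  rw [mem_betaSet]
  refine ⟨N - 1 - a, by omega, ?_⟩
  rw [rowLen_eq_zero (N := N - 1 - a) (by omega) le_rfl]
  omega

/-- The complement of the beta set is the beta set of the transpose, read backwards. -/
theorem holes_eq (hr : β.rowLen 0 ≤ N) (hc : β.colLen 0 ≤ N) :
    (range N).image (fun j => N + j - β.colLen j) = range (2 * N) \ betaSet β N := by
  have hcol : ∀ j, β.colLen j ≤ N := fun j => (β.colLen_anti 0 j (Nat.zero_le _)).trans hc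
  have hrow : ∀ j, β.rowLen j ≤ N := fun j => (β.rowLen_anti 0 j (Nat.zero_le _)).trans hr
  refine Finset.eq_of_subset_of_card_le ?_ ?_
  · intro b hb
    simp only [mem_image, mem_range] at hb
    obtain ⟨j, hj, rfl⟩ := hb
    have := hcol j
    rw [mem_sdiff, mem_range, mem_betaSet]
    refine ⟨by omega, ?_⟩
    rintro ⟨i, hi, h⟩
    have h1 := @YoungDiagram.mem_iff_lt_rowLen β i j
    have h2 := @YoungDiagram.mem_iff_lt_colLen β i j
    -- A common value would give `β.rowLen i + β.colLen j = i + j + 1`, but this sum is at least `i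
    -- + j + 2` inside `β` and at most `i + j` outside. Counting then gives equality of the sets.
    by_cases hm : (i, j) ∈ β
    · have := h1.1 hm
      have := h2.1 hm
      omega
    · have := not_lt.1 fun h => hm (h1.2 h)
      have := not_lt.1 fun h => hm (h2.2 h)
      omega
  · have h1 : betaSet β N ⊆ range (2 * N) := by
      intro a ha
      obtain ⟨i, hi, rfl⟩ := mem_betaSet.1 ha
      have := hrow i
      rw [mem_range]
      omega
    rw [Finset.card_sdiff_of_subset h1, card_betaSet, card_range, Finset.card_image_of_injOn]
    · rw [card_range]; omega
    · intro i hi j hj h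
      simp only [coe_range, Set.mem_Iio] at hi hj
      have e1 := hcol i
      have e2 := hcol j
      dsimp only at h
      rcases lt_trichotomy i j with hij | hij | hij
      · have := β.colLen_anti i j hij.le
        omega
      · exact hij
      · have := β.colLen_anti j i hij.le
        omega

/-- `hookExp β i j` is the hole `N + j - β.colLen j` minus the bead `β.rowLen i + (N - 1 - i)`. -/
theorem card_hookExp (hr : β.rowLen 0 ≤ N) (hc : β.colLen 0 ≤ N) (x : ℤ) :
    ((range N ×ˢ range N).filter fun c => hookExp β c.1 c.2 = x).card =
      ((betaSet β N).filter fun a : ℕ => 0 ≤ (a : ℤ) + x ∧ (a : ℤ) + x < 2 * N ∧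
        ((a : ℤ) + x).toNat ∉ betaSet β N).card := by
  have hcol : ∀ j, β.colLen j ≤ N := fun j => (β.colLen_anti 0 j (Nat.zero_le _)).trans hc
  refine Finset.card_bij (fun c _ => β.rowLen c.1 + (N - 1 - c.1)) ?_ ?_ ?_
  · rintro ⟨i, j⟩ h
    simp only [mem_filter, mem_product, mem_range] at h ⊢
    have hh := h.2
    unfold hookExp at hh
    have e := hcol j
    have hm : N + j - β.colLen j ∈ range (2 * N) \ betaSet β N := by
      rw [← holes_eq hr hc]
      exact mem_image.2 ⟨j, mem_range.2 h.1.2, rfl⟩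
    rw [mem_sdiff, mem_range] at hm
    refine ⟨mem_betaSet.2 ⟨i, h.1.1, rfl⟩, by omega, by omega, ?_⟩
    convert hm.2 using 2
    omega
  · rintro ⟨i, j⟩ h ⟨i', j'⟩ h' heq
    simp only [mem_filter, mem_product, mem_range] at h h'
    have hh := h.2
    have hh' := h'.2
    unfold hookExp at hh hh'
    obtain rfl : i = i' := betaSet_injOn β N (by simp; omega) (by simp; omega) (by simpa using heq)
    congr 1
    rcases lt_trichotomy j j' with hij | hij | hij
    · have := β.colLen_anti j j' hij.le
      omega
    · exact hij
    · have := β.colLen_anti j' j hij.le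
      omega
  · intro a ha
    simp only [mem_filter] at ha
    obtain ⟨ha, h0, h1, h2⟩ := ha
    obtain ⟨i, hi, rfl⟩ := mem_betaSet.1 ha
    have hm : ((β.rowLen i + (N - 1 - i) : ℕ) + x : ℤ).toNat ∈ range (2 * N) \ betaSet β N := by
      rw [mem_sdiff, mem_range]
      exact ⟨by omega, h2⟩
    rw [← holes_eq hr hc, mem_image] at hm
    obtain ⟨j, hj, hj'⟩ := hm
    rw [mem_range] at hj
    refine ⟨(i, j), ?_, rfl⟩
    have e := hcol j
    simp only [mem_filter, mem_product, mem_range]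
    refine ⟨⟨hi, hj⟩, ?_⟩
    unfold hookExp
    omega

theorem card_hookExp_pos {k : ℕ} (hr : β.rowLen 0 + k ≤ N) (hc : β.colLen 0 ≤ N) :
    ((range N ×ˢ range N).filter fun c => hookExp β c.1 c.2 = k).card =
      (upMoves k (betaSet β N)).card := by
  rw [card_hookExp (by omega) hc, upMoves]
  congr 1
  refine Finset.filter_congr fun a ha => ?_
  obtain ⟨i, hi, rfl⟩ := mem_betaSet.1 ha
  have := β.rowLen_anti 0 i (Nat.zero_le _)
  rw [← Nat.cast_add, Int.toNat_natCast]
  exact ⟨fun h => h.2.2, fun h => ⟨by omega, by omega, h⟩⟩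

theorem card_hookExp_neg {k : ℕ} (hr : β.rowLen 0 ≤ N) (hc : β.colLen 0 ≤ N) :
    ((range N ×ˢ range N).filter fun c => hookExp β c.1 c.2 = -k).card =
      (downMoves k (betaSet β N)).card := by
  rw [card_hookExp hr hc, downMoves]
  congr 1
  refine Finset.filter_congr fun a ha => ?_
  obtain ⟨i, hi, rfl⟩ := mem_betaSet.1 ha
  have := β.rowLen_anti 0 i (Nat.zero_le _)
  constructor
  · rintro ⟨h1, h2, h3⟩
    refine ⟨by omega, ?_⟩
    convert h3 using 2
    omega
  · rintro ⟨h1, h2⟩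
    refine ⟨by omega, by omega, ?_⟩
    convert h2 using 2
    omega

end

/-! ### Euler's product for partitions. -/

theorem exists_map_succ {X : Finset ℕ} (h : 0 ∉ X) : ∃ Y : Finset ℕ,
    X = Y.map ⟨Nat.succ, Nat.succ_injective⟩ := by
  refine ⟨X.image Nat.pred, ?_⟩
  ext a
  simp only [mem_map, mem_image, Function.Embedding.coeFn_mk, exists_exists_and_eq_and]
  constructor
  · intro ha
    exact ⟨a, ha, Nat.succ_pred_eq_of_ne_zero fun h0 => h (h0 ▸ ha)⟩
  · rintro ⟨b, hb, rfl⟩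
    rwa [Nat.succ_pred_eq_of_ne_zero fun h0 => h (h0 ▸ hb)]

theorem sum_map_succ (Y : Finset ℕ) :
    ∑ a ∈ Y.map ⟨Nat.succ, Nat.succ_injective⟩, a = ∑ a ∈ Y, a + Y.card := by
  simp [Finset.sum_map, Finset.sum_add_distrib]

theorem zero_notMem_map_succ (Y : Finset ℕ) : 0 ∉ Y.map ⟨Nat.succ, Nat.succ_injective⟩ := by
  simp

/-- Split by whether `0 ∈ X`, then discard 0 and shift down by 1. This keeps the excess `d` if 0 was
present and lowers it by `N + 1` otherwise. -/
theorem card_shiftedSets_succ (N d : ℕ) : (shiftedSets (N + 1) d).card =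
    (shiftedSets N d).card +
      if N + 1 ≤ d then (shiftedSets (N + 1) (d - (N + 1))).card else 0 := by
  rw [← Finset.card_filter_add_card_filter_not (s := shiftedSets (N + 1) d) (fun X => 0 ∈ X)]
  congr 1
  · symm
    refine Finset.card_bij
      (fun Y _ => insert 0 (Y.map ⟨Nat.succ, Nat.succ_injective⟩)) ?_ ?_ ?_
    · intro Y hY
      rw [mem_shiftedSets] at hY
      rw [mem_filter, mem_shiftedSets, card_insert_of_notMem (zero_notMem_map_succ Y), card_map,
        sum_insert (zero_notMem_map_succ Y), sum_map_succ, Finset.sum_range_succ]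
      exact ⟨⟨by omega, by omega⟩, mem_insert_self _ _⟩
    · intro Y _ Z _ h
      have h1 := congrArg (fun X => X.erase 0) h
      rw [erase_insert (zero_notMem_map_succ Y), erase_insert (zero_notMem_map_succ Z)] at h1
      exact Finset.map_injective _ h1
    · intro X hX
      rw [mem_filter, mem_shiftedSets, Finset.sum_range_succ] at hX
      obtain ⟨Y, hY⟩ := exists_map_succ (Finset.notMem_erase 0 X)
      refine ⟨Y, ?_, by rw [← hY, insert_erase hX.2]⟩
      have h1 := congrArg Finset.card hY
      have h2 := sum_map_succ Y
      rw [card_erase_of_mem hX.2, card_map] at h1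
      rw [← hY, Finset.sum_erase (f := fun a => a) X (a := 0) rfl] at h2
      rw [mem_shiftedSets]
      omega
  · split_ifs with hd
    · symm
      refine Finset.card_bij (fun Y _ => Y.map ⟨Nat.succ, Nat.succ_injective⟩) ?_ ?_ ?_
      · intro Y hY
        rw [mem_shiftedSets] at hY
        rw [mem_filter, mem_shiftedSets, card_map, sum_map_succ]
        exact ⟨⟨by omega, by omega⟩, zero_notMem_map_succ Y⟩
      · intro Y _ Z _ h
        exact Finset.map_injective _ h
      · intro X hX
        rw [mem_filter, mem_shiftedSets] at hX
        obtain ⟨Y, rfl⟩ := exists_map_succ hX.2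
        rw [card_map, sum_map_succ] at hX
        refine ⟨Y, ?_, rfl⟩
        rw [mem_shiftedSets]
        omega
    · rw [Finset.card_eq_zero, Finset.filter_eq_empty_iff]
      intro X hX h0
      rw [mem_shiftedSets] at hX
      obtain ⟨Y, rfl⟩ := exists_map_succ h0
      rw [card_map, sum_map_succ] at hX
      have := sum_range_le_sum hX.1
      omega

theorem prod_mul_shiftedSets (R : Type*) [CommRing R] (N : ℕ) :
    (∏ m ∈ Icc 1 N, (1 - (PowerSeries.X : PowerSeries R) ^ m)) *
      PowerSeries.mk (fun d => ((shiftedSets N d).card : R)) = 1 := by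
  induction N with
  | zero =>
    ext d
    rw [Finset.Icc_eq_empty (by simp), Finset.prod_empty, one_mul, PowerSeries.coeff_mk,
      PowerSeries.coeff_one]
    split_ifs with h
    · have : shiftedSets 0 d = {∅} := by
        ext X
        rw [mem_shiftedSets, Finset.card_eq_zero, Finset.mem_singleton, and_iff_left_iff_imp]
        rintro rfl
        simp [h]
      rw [this]
      simp
    · have : shiftedSets 0 d = ∅ := by
        rw [Finset.eq_empty_iff_forall_notMem]
        intro X hX
        rw [mem_shiftedSets, Finset.card_eq_zero] at hX
        obtain ⟨rfl, hX⟩ := hX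
        simp at hX
        omega
      rw [this]
      simp
  | succ N ih =>
    rw [Finset.prod_Icc_succ_top (by omega), mul_assoc]
    convert ih using 2
    ext d
    rw [sub_mul, one_mul, map_sub, PowerSeries.coeff_mk, PowerSeries.coeff_X_pow_mul',
      PowerSeries.coeff_mk, PowerSeries.coeff_mk, card_shiftedSets_succ]
    split_ifs <;> simp

theorem card_partitionsOfSize {N d : ℕ} (h : d ≤ N) :
    (partitionsOfSize d).card = (shiftedSets N d).card := by
  rw [Finset.card_eq_sum_ones, Finset.card_eq_sum_ones]
  exact sum_partitionsOfSize h fun _ => 1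

/-- Euler's generating function of partitions. -/
theorem eulerProduct_mul_partitionSum (R : Type*) [CommRing R] :
    eulerProduct R * partitionSum (fun _ => 1) = 1 := by
  ext d
  rw [← prod_mul_shiftedSets R d, PowerSeries.coeff_mul, PowerSeries.coeff_mul]
  refine Finset.sum_congr rfl fun x hx => ?_
  rw [Finset.HasAntidiagonal.mem_antidiagonal] at hx
  rw [coeff_prod_eq R (by omega : x.1 ≤ d), partitionSum, PowerSeries.coeff_mk,
    PowerSeries.coeff_mk, ← card_partitionsOfSize (by omega : x.2 ≤ d)]
  simp

/-! ### Recursion for the coefficients of the partition sum. -/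

/-- The sum over the partitions of size `d` of the coefficients of `p ^ x` in
`p * V_{(1)(1)β} / V_{∅∅β}`. -/
noncomputable def ratioCoeff (d : ℕ) (x : ℤ) : ℚ :=
  ∑ β ∈ partitionsOfSize d, (p * (V box box β / V ⊥ ⊥ β)).coeff x

/-- No bead can move by 0, so only the term 1 of each ratio contributes. -/
theorem ratioCoeff_zero (d : ℕ) : ratioCoeff d 0 = (partitionsOfSize d).card := by
  unfold ratioCoeff
  rw [Finset.card_eq_sum_ones, Nat.cast_sum]
  refine Finset.sum_congr rfl fun β hβ => ?_
  rw [mem_partitionsOfSize] at hβ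
  have h1 := rowLen_le_card β
  have h2 := colLen_le_card β
  have h3 := axisCells_le_card β
  rw [coeff_vertex_ratio (N := 2 * d + 1) (by omega) (by omega)]
  have := card_hookExp_pos (β := β) (N := 2 * d + 1) (k := 0) (by omega) (by omega)
  rw [Nat.cast_zero] at this
  rw [this]
  simp [upMoves]

theorem ratioCoeff_pos {d k N : ℕ} (hk : 0 < k) (hN : 2 * d + k < N) :
    ratioCoeff d k = ((∑ X ∈ shiftedSets N d, (upMoves k X).card : ℕ) : ℚ) := by
  unfold ratioCoeff
  rw [← sum_partitionsOfSize (by omega : d ≤ N) fun X => (upMoves k X).card, Nat.cast_sum]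
  refine Finset.sum_congr rfl fun β hβ => ?_
  rw [mem_partitionsOfSize] at hβ
  have h1 := rowLen_le_card β
  have h2 := colLen_le_card β
  have h3 := axisCells_le_card β
  rw [coeff_vertex_ratio (N := N) (by omega) (by omega), card_hookExp_pos (by omega) (by omega),
    if_neg (by omega), zero_add]

theorem ratioCoeff_neg {d k N : ℕ} (hk : 0 < k) (hN : 2 * d < N) :
    ratioCoeff d (-k) = ((∑ X ∈ shiftedSets N d, (downMoves k X).card : ℕ) : ℚ) := by
  unfold ratioCoeff
  rw [← sum_partitionsOfSize (by omega : d ≤ N) fun X => (downMoves k X).card, Nat.cast_sum]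
  refine Finset.sum_congr rfl fun β hβ => ?_
  rw [mem_partitionsOfSize] at hβ
  have h1 := rowLen_le_card β
  have h2 := colLen_le_card β
  have h3 := axisCells_le_card β
  rw [coeff_vertex_ratio (N := N) (by omega) (by omega), card_hookExp_neg (by omega) (by omega),
    if_neg (by omega), zero_add]

theorem ratioCoeff_eq_add {d k : ℕ} (hk : 0 < k) :
    ratioCoeff d k = ratioCoeff d (-k) + k * (partitionsOfSize d).card := by
  rw [ratioCoeff_pos hk (N := 2 * d + k + 1) (by omega),
    ratioCoeff_neg hk (N := 2 * d + k + 1) (by omega)]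
  rw [← sum_partitionsOfSize (by omega : d ≤ 2 * d + k + 1) fun X => (upMoves k X).card,
    ← sum_partitionsOfSize (by omega : d ≤ 2 * d + k + 1) fun X => (downMoves k X).card]
  have : ∀ β ∈ partitionsOfSize d, (upMoves k (betaSet β (2 * d + k + 1))).card =
      (downMoves k (betaSet β (2 * d + k + 1))).card + k := by
    intro β hβ
    rw [mem_partitionsOfSize] at hβ
    have := colLen_le_card β
    exact card_upMoves (range_subset_betaSet (by omega))
  rw [Finset.sum_congr rfl this, Finset.sum_add_distrib]
  simp
  ring

theorem ratioCoeff_shift {d k : ℕ} (hk : 0 < k) :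
    ratioCoeff (d + k) (-k) = ratioCoeff d k := by
  rw [ratioCoeff_pos hk (N := 2 * (d + k) + 1) (by omega),
    ratioCoeff_neg hk (N := 2 * (d + k) + 1) (by omega), sum_upMoves hk]

theorem ratioCoeff_neg_of_lt {d k : ℕ} (h : d < k) : ratioCoeff d (-k) = 0 := by
  rw [ratioCoeff_neg (N := 2 * d + 1) (by omega) (by omega), Nat.cast_eq_zero]
  exact Finset.sum_eq_zero fun X hX => by rw [downMoves_eq_empty h hX, card_empty]

/-- Iteration of `c_{d+k}(-k) = c_d(-k) + k P(d)` down to sizes below `k`, where no down move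
exists. The indices `j` reached are the positive multiples of `k`; `Nat.divisors 0 = ∅` excludes `j
= 0`. -/
theorem ratioCoeff_neg_eq {k : ℕ} (hk : 0 < k) (d : ℕ) :
    ratioCoeff d (-k) = ∑ j ∈ range (d + 1),
      (if k ∈ j.divisors then (k : ℚ) else 0) * ((partitionsOfSize (d - j)).card : ℚ) := by
  induction d using Nat.strong_induction_on with
  | _ d ih =>
  have hlt : ∀ j < k, k ∉ j.divisors := by
    intro j hj h
    have := Nat.divisor_le h
    omega
  rcases Nat.lt_or_ge d k with hd | hd
  · rw [ratioCoeff_neg_of_lt hd]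
    symm
    refine Finset.sum_eq_zero fun j hj => ?_
    rw [Finset.mem_range] at hj
    rw [if_neg (hlt j (by omega)), zero_mul]
  · obtain ⟨e, rfl⟩ := Nat.exists_eq_add_of_le' hd
    -- The sum is cut at `j = k`: smaller `j` contribute nothing, `j = k` gives the new term, and
    -- larger `j` match the sum for `e` shifted by `k`.
    rw [ratioCoeff_shift hk, ratioCoeff_eq_add hk, ih e (by omega),
      show e + k + 1 = k + (e + 1) by ring, Finset.sum_range_add _ k (e + 1),
      Finset.sum_eq_zero (s := range k), zero_add, Finset.sum_range_succ', Finset.sum_range_succ' _ e, if_neg (by simp), if_pos (by simp; omega)]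
    · simp only [add_zero, Nat.add_sub_cancel, Nat.sub_zero, zero_mul]
      congr 1
      refine Finset.sum_congr rfl fun j _ => ?_
      have h1 : k ∈ (k + (j + 1)).divisors ↔ k ∈ (j + 1).divisors := by
        rw [Nat.mem_divisors, Nat.mem_divisors, Nat.dvd_add_right dvd_rfl]
        simp
      have h2 : e + k - (k + (j + 1)) = e - (j + 1) := by omega
      rw [h2]
      congr 1
      exact (if_congr h1 rfl rfl).symm
    · intro j hj
      rw [if_neg (hlt j (Finset.mem_range.1 hj)), zero_mul]

/-! ### The right hand side and the final comparison. -/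

theorem p_div_one_sub_sq : p / (1 - p) ^ 2 =
    HahnSeries.ofPowerSeries ℤ ℚ (PowerSeries.mk fun n => (n : ℚ)) := by
  have hX : HahnSeries.ofPowerSeries ℤ ℚ PowerSeries.X = p := HahnSeries.ofPowerSeries_X
  have h1 : (PowerSeries.mk fun n => (n : ℚ)) * (1 - PowerSeries.X) =
      PowerSeries.X * PowerSeries.mk 1 := by
    ext n
    rw [mul_sub, mul_one, map_sub]
    cases n with
    | zero => simp
    | succ n => simp [PowerSeries.coeff_succ_mul_X, PowerSeries.coeff_succ_X_mul]
  have h2 : (PowerSeries.mk fun n => (n : ℚ)) * (1 - PowerSeries.X) ^ 2 = PowerSeries.X := by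
    rw [pow_two, ← mul_assoc, h1, mul_assoc, PowerSeries.mk_one_mul_one_sub_eq_one, mul_one]
  have hp : (1 - p) ≠ 0 := by
    intro h
    have h3 : HahnSeries.ofPowerSeries ℤ ℚ (1 - PowerSeries.X) = 0 := by
      rw [map_sub, map_one, hX, h]
    rw [map_eq_zero_iff _ HahnSeries.ofPowerSeries_injective] at h3
    have h4 := congrArg PowerSeries.constantCoeff h3
    simp at h4
  rw [div_eq_iff (pow_ne_zero 2 hp)]
  have h3 := congrArg (HahnSeries.ofPowerSeries ℤ ℚ) h2
  rw [map_mul, map_pow, map_sub, map_one, hX] at h3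
  exact h3.symm

/-- The coefficient of `q ^ d` of the right hand side. -/
noncomputable def divisorTerm (d : ℕ) : LaurentSeries ℚ :=
  ∑ k ∈ d.divisors, (k : LaurentSeries ℚ) * (p ^ (k : ℤ) + p ^ (-(k : ℤ)))

theorem coeff_natCast_mul (n : ℕ) (f : LaurentSeries ℚ) (x : ℤ) :
    ((n : LaurentSeries ℚ) * f).coeff x = n * f.coeff x := by
  rw [← nsmul_eq_mul, HahnSeries.coeff_nsmul, Pi.smul_apply, nsmul_eq_mul]

theorem coeff_divisorTerm (d : ℕ) (x : ℤ) : (divisorTerm d).coeff x =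
    if x.natAbs ∈ d.divisors then (x.natAbs : ℚ) else 0 := by
  rw [divisorTerm, HahnSeries.coeff_sum]
  have h : ∀ k ∈ d.divisors,
      ((k : LaurentSeries ℚ) * (p ^ (k : ℤ) + p ^ (-(k : ℤ)))).coeff x =
        if x.natAbs = k then (k : ℚ) else 0 := by
    intro k hk
    have hk0 := Nat.pos_of_mem_divisors hk
    rw [coeff_natCast_mul, HahnSeries.coeff_add, p_zpow, p_zpow, HahnSeries.coeff_single,
      HahnSeries.coeff_single]
    by_cases h1 : x = k
    · rw [if_pos h1, if_neg (by omega), if_pos (by omega)]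
      ring
    · by_cases h2 : x = -k
      · rw [if_neg h1, if_pos h2, if_pos (by omega)]
        ring
      · rw [if_neg h1, if_neg h2, if_neg (by omega)]
        ring
  rw [Finset.sum_congr rfl h, Finset.sum_ite_eq]

theorem coeff_constant_term (x : ℤ) : (1 + p / (1 - p) ^ 2).coeff x =
    if x = 0 then 1 else if 0 < x then (x : ℚ) else 0 := by
  rw [HahnSeries.coeff_add, p_div_one_sub_sq, HahnSeries.coeff_one]
  rcases lt_or_ge x 0 with hx | hx
  · rw [HahnSeries.ofPowerSeries_apply, HahnSeries.embDomain_of_notMem_range, add_zero]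
    · split_ifs <;> first | rfl | omega
    rintro ⟨n, hn⟩
    simp at hn
    omega
  · lift x to ℕ using hx
    rw [HahnSeries.ofPowerSeries_apply_coeff, PowerSeries.coeff_mk]
    by_cases h : x = 0
    · simp [h]
    · rw [if_neg (by omega), if_neg (by omega), if_pos (by omega), zero_add, Int.cast_natCast]

/-- The divisor terms are symmetric under `x ↦ -x`. The asymmetry `k P(d)` of `ratioCoeff_eq_add` is
the contribution of `p / (1 - p) ^ 2`, and the case `x = 0` that of the constant 1. -/
theorem ratioCoeff_eq (d : ℕ) (x : ℤ) : ratioCoeff d x =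
    (1 + p / (1 - p) ^ 2).coeff x * (partitionsOfSize d).card +
      ∑ j ∈ range (d + 1), (divisorTerm j).coeff x * (partitionsOfSize (d - j)).card := by
  simp_rw [coeff_divisorTerm]
  rw [coeff_constant_term]
  rcases lt_trichotomy x 0 with hx | rfl | hx
  · obtain ⟨k, rfl⟩ : ∃ k : ℕ, x = -k := ⟨x.natAbs, by omega⟩
    rw [ratioCoeff_neg_eq (by omega), if_neg (by omega), if_neg (by omega), zero_mul, zero_add]
    simp
  · rw [ratioCoeff_zero, if_pos rfl, one_mul]
    simp
  · lift x to ℕ using hx.le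
    rw [ratioCoeff_eq_add (by omega), ratioCoeff_neg_eq (by omega), if_neg (by omega), if_pos hx,
      add_comm]
    simp

theorem partitionSum_ratio_eq :
    partitionSum (fun β : YoungDiagram => p * (V box box β / V ⊥ ⊥ β)) =
      (PowerSeries.C (1 + p / (1 - p) ^ 2) + PowerSeries.mk divisorTerm) *
        partitionSum (fun _ => 1) := by
  ext d x
  rw [add_mul, map_add, PowerSeries.coeff_C_mul, PowerSeries.coeff_mul,
    Finset.Nat.sum_antidiagonal_eq_sum_range_succ (fun i j =>
      PowerSeries.coeff i (PowerSeries.mk divisorTerm) *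
        PowerSeries.coeff j (partitionSum (fun _ => (1 : LaurentSeries ℚ))))]
  simp only [partitionSum, PowerSeries.coeff_mk, Finset.sum_const, nsmul_one]
  rw [HahnSeries.coeff_sum, HahnSeries.coeff_add, HahnSeries.coeff_sum]
  simp only [mul_comm _ ((Nat.cast _ : LaurentSeries ℚ)), coeff_natCast_mul]
  have h := ratioCoeff_eq d x
  unfold ratioCoeff at h
  rw [h, mul_comm]
  congr 1
  exact Finset.sum_congr rfl fun j _ => mul_comm _ _

end TopVertex

theorem mainTheorem3 :
    TopVertex.eulerProduct (LaurentSeries ℚ) *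
        TopVertex.partitionSum (fun β : YoungDiagram =>
          TopVertex.p * (TopVertex.V TopVertex.box TopVertex.box β / TopVertex.V ⊥ ⊥ β)) =
      PowerSeries.C (1 + TopVertex.p / (1 - TopVertex.p) ^ 2) +
        PowerSeries.mk (fun d : ℕ =>
          ∑ k ∈ d.divisors,
            (k : LaurentSeries ℚ) * (TopVertex.p ^ (k : ℤ) + TopVertex.p ^ (-(k : ℤ)))) := by
  rw [TopVertex.partitionSum_ratio_eq, mul_left_comm, TopVertex.eulerProduct_mul_partitionSum,
    mul_one]
  rfl
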